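/- **Theorem (full counting statistics of planar symplectic ensembles).** For $N\ge 1$ let $W_N(z)=g_N(|z|)$ be a rotationally invariant potential $W_N:\mathbb C\to\mathbb R$, and write $\Delta=\partial\bar\partial=\frac14(\partial_x^2+\partial_y^2)$. Assume that $(W_N)$ is *suitable*, i.e. $g_N$ is twice differentiable on $(0,\infty)$ and 1. for every $N$, $g_N(r)/\log r\to\infty$ as $r\to\infty$; 2. $g_N\in C^2(0,1]$; 3. $r\,g_N'(r)$ is strictly increasing on $(0,\infty)$, and $\Delta W_N(z)>0$ for all $z\ne0$; 4. $\lim_{r\to0} r\,g_N'(r)=0$ for every $N$, and $\lim_{N\to\infty} g_N'(1)=4$. Assume moreover that the dependence of $W_N$ on $N$ is regular: there are $b>1$ and a function $D:(0,b)\to\mathbb R$, positive on $(0,1]$, such that $\Delta W_N(r)\to D(r)$ as $N\to\infty$, locally uniformly in $r\in(0,b)$. (This holds automatically if $W_N=W$ does not depend on $N$.) Let $(z_1,\dots,z_N)\in\mathbb C^N$ be distributed according to the probability density proportional to $$\prod_{1\le k<j\le N}|z_j-z_k|^2\,|z_j-\overline z_k|^2\ \prod_{l=1}^N|z_l-\overline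 z_l|^2e^{-NW_N(z_l)},$$ let $\mathcal N_a=\#\{j:|z_j|\le a\}$, and let $\kappa_p(a)=\frac{d^p}{du^p}\log\mathbb E\big[e^{u\mathcal N_a}\big]\big|_{u=0}$ be its $p$-th cumulant (it depends on $N$). Let $\operatorname{erfc}(x)=\frac2{\sqrt\pi}\int_x^\infty e^{-t^2}dt$, and let $\operatorname{Li}_s$ be the polylogarithm, i.e. the analytic continuation to $\mathbb C\setminus[1,\infty)$ of $\sum_{k\ge1}k^{-s}z^k$, $|z|<1$. Let $p\ge2$ be an integer. The function $x\mapsto \operatorname{Li}_{1-p}\big(-\frac{\operatorname{erfc}(-x)}{\operatorname{erfc}(x)}\big)$ is integrable on $\mathbb R$, and the following holds. (i) *Bulk.* For every fixed $a\in(0,1)$, $$\lim_{N\to\infty}\sqrt{\frac{2}{N\,\Delta W_N(a)}}\;\kappa_p(a)=a\,\kappa_p^{\rm bulk},\qquad \kappa_p^{\rm bulk}:=(-1)^{p+1}\int_{-\infty}^{\infty}\operatorname{Li}_{1-p}\Big(-\frac{\operatorname{erfc}(-x)}{\operatorname{erfc}(x)}\Big)dx .$$ Here $\kappa_p^{\rm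 bulk}=-\int_{-\infty}^{\infty}\operatorname{Li}_{1-p}\big(-\frac{\operatorname{erfc}(-x)}{\operatorname{erfc}(x)}\big)dx$ if $p$ is even, and $\kappa_p^{\rm bulk}=0$ if $p$ is odd. (ii) *Edge.* Suppose in addition that $\sqrt N\,(g_N'(1)-4)\to0$ as $N\to\infty$ (automatic if $W_N$ does not depend on $N$). For $\mathcal S\in\mathbb R$ put $a=a_N=1-\dfrac{\mathcal S}{\sqrt{2\,\Delta W_N(1)\,N}}$. Then $$\lim_{N\to\infty}\sqrt{\frac{2}{N\,\Delta W_N(1)}}\;\kappa_p(a_N)=\kappa_p^{\rm edge}(\mathcal S):=(-1)^{p+1}\int_{-\infty}^{\mathcal S}\operatorname{Li}_{1-p}\Big(-\frac{\operatorname{erfc}(-x)}{\operatorname{erfc}(x)}\Big)dx .$$ -/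

import Mathlib

/-! ### Special functions -/

/-- The complementary error function `erfc x = (2 / √π) ∫_x^∞ e^{-t²} dt`. -/
noncomputable def erfc (x : ℝ) : ℝ :=
  2 / Real.sqrt Real.pi * ∫ t in Set.Ioi x, Real.exp (-t ^ 2)

/-- The defining series `∑_{k ≥ 1} k^{-s} z^k` of the polylogarithm, convergent for `|z| < 1`. -/
noncomputable def polylogSeries (s z : ℂ) : ℂ :=
  ∑' k : ℕ, ((k : ℂ) + 1) ^ (-s) * z ^ (k + 1)

/-- The cut plane `ℂ ∖ [1, ∞)`. -/
def polylogDomain : Set ℂ := {z | 1 - z ∈ Complex.slitPlane}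

/-- `L` is the analytic continuation to `ℂ ∖ [1, ∞)` of the polylogarithm series of order `s`.
As the domain is open and connected and contains the unit disc, such an `L` is unique there. -/
def IsPolylog (s : ℂ) (L : ℂ → ℂ) : Prop :=
  AnalyticOnNhd ℂ L polylogDomain ∧ ∀ z ∈ Metric.ball (0 : ℂ) 1, L z = polylogSeries s z

open Classical in
/-- The polylogarithm `Li_s`, defined on `ℂ ∖ [1, ∞)` by analytic continuation of its series. -/
noncomputable def polylog (s : ℂ) : ℂ → ℂ :=
  if h : ∃ L, IsPolylog s L then h.choose else 0

/-- The continuation exists for the orders `0, -1, -2, …`, so `polylog` is not a junk value. -/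
theorem isPolylog_polylog_neg_nat (n : ℕ) :
    IsPolylog (-(n : ℂ)) (polylog (-(n : ℂ))) := by
  have hex : ∃ L, IsPolylog (-(n : ℂ)) L := by
    induction n with
    | zero =>
      refine ⟨fun z => z * (1 - z)⁻¹, ?_, ?_⟩
      · intro z hz
        have h0 : (1 : ℂ) - z ≠ 0 := Complex.slitPlane_ne_zero hz
        exact analyticAt_id.mul ((analyticAt_const.sub analyticAt_id).inv h0)
      · intro z hz
        have hz' : ‖z‖ < 1 := by simpa using hz
        have := ((hasSum_geometric_of_norm_lt_one hz').mul_left z).tsum_eq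
        simp only [polylogSeries]
        rw [← this]
        congr 1
        ext k
        simp [pow_succ']
    | succ n ih =>
      obtain ⟨L, hL, hs⟩ := ih
      refine ⟨fun z => z * deriv L z, fun z hz => analyticAt_id.mul (hL z hz).deriv, ?_⟩
      intro z hz
      have hz' : ‖z‖ < 1 := by simpa using hz
      obtain ⟨r, hzr, hr1⟩ := exists_between hz'
      have hr0 : 0 ≤ r := (norm_nonneg z).trans hzr.le
      have hev : L =ᶠ[nhds z] polylogSeries (-(n : ℂ)) := by
        filter_upwards [Metric.isOpen_ball.mem_nhds hz] with w hw using hs w hw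
      have hsum : Summable fun k : ℕ => ((k + 1 : ℕ) : ℝ) ^ n * r ^ (k + 1) :=
        (summable_nat_add_iff (f := fun k : ℕ => (k : ℝ) ^ n * r ^ k) 1).2
          (summable_pow_mul_geometric_of_norm_lt_one n
            (by rwa [Real.norm_eq_abs, abs_of_nonneg hr0]))
      have key := Complex.hasSum_deriv_of_summable_norm
        (F := fun (k : ℕ) (w : ℂ) => ((k : ℂ) + 1) ^ (-(-(n : ℂ))) * w ^ (k + 1))
        (U := Metric.ball 0 r) hsum
        (fun k => (by fun_prop : Differentiable ℂ _).differentiableOn) Metric.isOpen_ball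
        (fun k w hw => by
          have hw' : ‖w‖ ≤ r := by simpa using (Metric.mem_ball.1 hw).le
          have hk : ‖((k : ℂ) + 1)‖ = (k : ℝ) + 1 := by
            rw [← Nat.cast_add_one, Complex.norm_natCast]; simp
          rw [neg_neg, Complex.cpow_natCast, norm_mul, norm_pow, norm_pow, hk]
          push_cast
          gcongr)
        (by simpa using hzr : z ∈ Metric.ball (0 : ℂ) r)
      have hd : deriv L z = _ := hev.deriv_eq.trans key.tsum_eq.symm
      simp only [hd, polylogSeries]
      rw [← tsum_mul_left]
      congr 1
      ext k
      have hd' : deriv (fun w : ℂ => ((k : ℂ) + 1) ^ (-(-(n : ℂ))) * w ^ (k + 1)) z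
          = ((k : ℂ) + 1) ^ (-(-(n : ℂ))) * (((k : ℂ) + 1) * z ^ k) := by
        rw [deriv_const_mul_field, deriv_pow_field]
        push_cast
        simp
      rw [hd', neg_neg, neg_neg, Complex.cpow_natCast, Complex.cpow_natCast]
      ring
  rw [polylog, dif_pos hex]
  exact hex.choose_spec

/-! ### Planar symplectic ensembles -/

/-- The rotationally invariant potential `W(z) = g(|z|)`. -/
noncomputable def radialPotential (g : ℝ → ℝ) (z : ℂ) : ℝ := g ‖z‖

/-- `Δ = ∂ ∂̄ = (∂_x² + ∂_y²) / 4`, one quarter of the usual Laplacian. -/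
noncomputable def quarterLaplacian (W : ℂ → ℝ) (z : ℂ) : ℝ :=
  1 / 4 * Laplacian.laplacian W z

/-- The unnormalised joint density of the planar symplectic ensemble with potential `W`,
`∏_{j > k} |z_j - z_k|² |z_j - z̄_k|² ∏_l |z_l - z̄_l|² e^{-N W(z_l)}`. -/
noncomputable def symplecticWeight (N : ℕ) (W : ℂ → ℝ) (z : Fin N → ℂ) : ℝ :=
  (∏ j, ∏ k ∈ Finset.Iio j,
    ‖z j - z k‖ ^ 2 * ‖z j - (starRingEnd ℂ) (z k)‖ ^ 2) *
  ∏ l, ‖z l - (starRingEnd ℂ) (z l)‖ ^ 2 * Real.exp (-(N * W (z l)))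

/-- The law of the planar symplectic ensemble: the joint density normalised by the partition
function. Replacing the Lebesgue measure `d²z` by `d²z / π` does not change this law. -/
noncomputable def symplecticEnsemble (N : ℕ) (W : ℂ → ℝ) : MeasureTheory.Measure (Fin N → ℂ) :=
  MeasureTheory.volume.withDensity fun z =>
    ENNReal.ofReal (symplecticWeight N W z / ∫ w, symplecticWeight N W w)

/-- `𝒩_a = #{j : |z_j| ≤ a}`. -/
noncomputable def discCount {N : ℕ} (a : ℝ) (z : Fin N → ℂ) : ℝ :=
  ((Finset.univ.filter fun j => ‖z j‖ ≤ a).card : ℝ)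

/-- The `p`-th cumulant `κ_p(a)` of `𝒩_a`: the `p`-th derivative at `u = 0` of `log 𝔼[e^{u 𝒩_a}]`. -/
noncomputable def discCumulant (N : ℕ) (W : ℂ → ℝ) (p : ℕ) (a : ℝ) : ℝ :=
  iteratedDeriv p (ProbabilityTheory.cgf (discCount a) (symplecticEnsemble N W)) 0

/-- The rotationally invariant potentials `W_N(z) = g_N(|z|)`, `N ≥ 1`, are suitable. -/
structure IsSuitable (g : ℕ → ℝ → ℝ) : Prop where
  growth : ∀ N, 1 ≤ N →
    Filter.Tendsto (fun r => g N r / Real.log r) Filter.atTop Filter.atTop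
  differentiable : ∀ N, 1 ≤ N → DifferentiableOn ℝ (g N) (Set.Ioi 0)
  differentiable_deriv : ∀ N, 1 ≤ N → DifferentiableOn ℝ (deriv (g N)) (Set.Ioi 0)
  contDiff : ∀ N, 1 ≤ N → ContDiffOn ℝ 2 (g N) (Set.Ioc 0 1)
  increasing : ∀ N, 1 ≤ N → StrictMonoOn (fun r => r * deriv (g N) r) (Set.Ioi 0)
  laplacian_pos : ∀ N, 1 ≤ N → ∀ z : ℂ, z ≠ 0 →
    0 < quarterLaplacian (radialPotential (g N)) z
  tendsto_zero : ∀ N, 1 ≤ N →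
    Filter.Tendsto (fun r => r * deriv (g N) r) (nhdsWithin 0 (Set.Ioi 0)) (nhds 0)
  tendsto_one : Filter.Tendsto (fun N => deriv (g N) 1) Filter.atTop (nhds 4)

/-- The dependence of the potentials on `N` is regular: near the punctured closed unit disc,
`ΔW_N` converges locally uniformly, and its limit does not vanish on the punctured closed disc.
A sequence of suitable potentials that does not depend on `N` satisfies this automatically. -/
def HasRegularLimit (g : ℕ → ℝ → ℝ) : Prop :=
  ∃ (D : ℝ → ℝ) (b : ℝ), 1 < b ∧ (∀ r ∈ Set.Ioc (0 : ℝ) 1, 0 < D r) ∧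
    TendstoLocallyUniformlyOn
      (fun N (r : ℝ) => quarterLaplacian (radialPotential (g N)) (r : ℂ)) D
      Filter.atTop (Set.Ioo 0 b)

/-! ### Limiting cumulants -/

/-- `Li_{1-p}(-erfc(-x) / erfc(x))`; the value is real, since `Li_{1-p}` is real on `(-∞, 1)`. -/
noncomputable def polylogErfc (p : ℕ) (x : ℝ) : ℝ :=
  (polylog (1 - (p : ℂ)) ((-(erfc (-x) / erfc x) : ℝ) : ℂ)).re

noncomputable def bulkCumulant (p : ℕ) : ℝ :=
  (-1) ^ (p + 1) * ∫ x, polylogErfc p x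

noncomputable def edgeCumulant (p : ℕ) (S : ℝ) : ℝ :=
  (-1) ^ (p + 1) * ∫ x in Set.Iic S, polylogErfc p x

/-!
The weight of the ensemble is, up to a constant sign, `∏ (z_l - z̄_l) e^{-N W(z_l)}` times the
Vandermonde determinant of the `2 N` points `z_1, …, z_N, z̄_1, …, z̄_N`. After expanding the
determinant and integrating a product of radial functions, the angular integrals kill every
permutation except those that match the degrees `0, …, 2 N - 1` into the pairs `{0, 1}, {2, 3}, …`.
So such expectations factorize (`exists_integral_symplecticFactor`), and the number of points in the
disc of radius `a` is distributed as a sum of independent Bernoulli variables (`mgf_discCount`). In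
the coordinate `r = a e^{s / √N}` the success probability of index `k` is the mass of `s ≤ 0` under
the density proportional to `exp (y s - Γ_N s)`, where `y = (4 k - N q_N(a)) / √N`,
`q_N(r) = r g_N'(r)`, and `Γ_N` is convex with minimum `0` at `0` (`moment_ratio_eq`).

Since `q_N' (r) = 4 r ΔW_N(r)` converges locally uniformly, `q_N` has a first-order expansion that
is uniform in `N` (`exists_uniform_linear_approx`), whence `Γ_N s → c s ^ 2 / 2` with
`c = 4 a ^ 2 D(a)`. Convexity of `Γ_N` upgrades this pointwise convergence to what dominated
convergence needs: the success probabilities tend to `erfc (y / √(2 c)) / 2`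
(`tendsto_tiltedProb`), and they approach `0` or `1` exponentially fast in `|y|`, uniformly in `N`
(`IsConvexWell.tiltedProb_mul_le`). The cumulant of order `p ≥ 2` of a Bernoulli variable is a
polynomial in the success probability that vanishes at `0` and `1`, so the sum over `k` is a
dominated Riemann sum of mesh `4 / √N` in `y` (`tendsto_sum_tiltedProb`). Its range exhausts the
line in the bulk and a half-line at the edge.

Both `d/du` acting on Bernoulli cumulants and `z d/dz` acting on polylogarithms take the form
`y (1 - y) d/dy`, with `y` the success probability, respectively `y = -z / (1 - z)`. This identifies
the limiting integrand with `Li_{1-p}(-erfc(-x) / erfc(x))` up to sign (`polylog_neg_nat`).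
-/

open Filter Topology MeasureTheory ComplexConjugate

/-! ### Cumulants of Bernoulli variables -/

section

open Polynomial

/-- `bernoulliCumulantPoly n` is the polynomial in the success probability `x` whose value is the
cumulant of order `n + 1` of a Bernoulli variable. -/
noncomputable def bernoulliCumulantPoly : ℕ → ℝ[X]
  | 0 => X
  | n + 1 => X * (1 - X) * derivative (bernoulliCumulantPoly n)

theorem bernoulliCumulantPoly_comp_one_sub (n : ℕ) :
    (bernoulliCumulantPoly (n + 1)).comp (1 - X) = (-1) ^ n * bernoulliCumulantPoly (n + 1) := by
  induction n with
  | zero => simp [bernoulliCumulantPoly]; ring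
  | succ n ih =>
    have h := congrArg derivative ih
    rw [derivative_comp] at h
    have h1 : derivative ((-1 : ℝ[X]) ^ n * bernoulliCumulantPoly (n + 1))
        = (-1) ^ n * derivative (bernoulliCumulantPoly (n + 1)) := by
      rcases neg_one_pow_eq_or ℝ[X] n with h | h <;> simp [h]
    rw [h1] at h
    have h2 : (derivative (bernoulliCumulantPoly (n + 1))).comp (1 - X)
        = (-1) ^ (n + 1) * derivative (bernoulliCumulantPoly (n + 1)) := by
      simp only [derivative_sub, derivative_one, derivative_X] at h
      linear_combination -h
    rw [bernoulliCumulantPoly, mul_comp, h2]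
    simp only [mul_comp, sub_comp, one_comp, X_comp]
    ring

/-- Cumulants of order `≥ 2` are even or odd under the exchange of success and failure. -/
theorem eval_one_sub_bernoulliCumulantPoly (n : ℕ) (x : ℝ) :
    (bernoulliCumulantPoly (n + 1)).eval (1 - x)
      = (-1) ^ n * (bernoulliCumulantPoly (n + 1)).eval x := by
  have := congrArg (eval x) (bernoulliCumulantPoly_comp_one_sub n)
  simpa [eval_comp] using this

theorem exists_abs_eval_bernoulliCumulantPoly_le (n : ℕ) :
    ∃ C, 0 ≤ C ∧ ∀ x ∈ Set.Icc (0 : ℝ) 1,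
      |(bernoulliCumulantPoly (n + 1)).eval x| ≤ C * (x * (1 - x)) := by
  obtain ⟨C, hC⟩ := (isCompact_Icc (a := (0 : ℝ)) (b := 1)).exists_bound_of_continuousOn
    (derivative (bernoulliCumulantPoly n)).continuous.continuousOn
  refine ⟨C, (norm_nonneg _).trans (hC 0 (by simp)), fun x hx => ?_⟩
  have h : 0 ≤ x * (1 - x) := mul_nonneg hx.1 (by linarith [hx.2])
  rw [bernoulliCumulantPoly, eval_mul, abs_mul]
  simp only [eval_mul, eval_X, eval_sub, eval_one]
  rw [abs_of_nonneg h, mul_comm C]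
  exact mul_le_mul_of_nonneg_left (hC x hx) h

theorem iteratedDeriv_log_bernoulli (n : ℕ) {x : ℝ} (hx : x ∈ Set.Icc (0 : ℝ) 1) :
    iteratedDeriv (n + 1) (fun u => Real.log (1 - x + x * Real.exp u))
      = fun u => (bernoulliCumulantPoly n).eval
          (x * Real.exp u / (1 - x + x * Real.exp u)) := by
  have hpos : ∀ u, 0 < 1 - x + x * Real.exp u := by
    intro u
    rcases hx.1.eq_or_lt with h | h
    · simp [← h]
    · have := mul_pos h (Real.exp_pos u)
      linarith [hx.2]
  have hd : ∀ u, HasDerivAt (fun u => 1 - x + x * Real.exp u) (x * Real.exp u) u := fun u =>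
    ((Real.hasDerivAt_exp u).const_mul x).const_add _
  induction n with
  | zero =>
    rw [zero_add, iteratedDeriv_one]
    ext u
    simpa [bernoulliCumulantPoly] using ((hd u).log (hpos u).ne').deriv
  | succ n ih =>
    rw [iteratedDeriv_succ, ih]
    ext u
    have h1 := ((Real.hasDerivAt_exp u).const_mul x).div (hd u) (hpos u).ne'
    have h2 := ((bernoulliCumulantPoly n).hasDerivAt
      (x * Real.exp u / (1 - x + x * Real.exp u))).comp u h1
    refine h2.deriv.trans ?_
    have := (hpos u).ne'
    simp only [bernoulliCumulantPoly, eval_mul, eval_X, eval_sub, eval_one]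
    rw [mul_comm]
    congr 1
    field_simp

theorem contDiff_log_bernoulli {x : ℝ} (hx : x ∈ Set.Icc (0 : ℝ) 1) {n : WithTop ℕ∞} :
    ContDiff ℝ n (fun u => Real.log (1 - x + x * Real.exp u)) := by
  refine ContDiff.log (by fun_prop) fun u => ne_of_gt ?_
  rcases hx.1.eq_or_lt with h | h
  · simp [← h]
  · have := mul_pos h (Real.exp_pos u)
    linarith [hx.2]

/-! ### Polylogarithms of nonpositive integer order -/

theorem isPreconnected_polylogDomain : IsPreconnected polylogDomain := by
  have h : polylogDomain = (fun z : ℂ => 1 - z) '' Complex.slitPlane := by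
    ext z
    constructor
    · intro hz
      exact ⟨1 - z, hz, by simp⟩
    · rintro ⟨w, hw, rfl⟩
      simpa [polylogDomain] using hw
  rw [h]
  exact (Complex.starConvex_one_slitPlane.isPathConnected
    Complex.one_mem_slitPlane |>.isConnected.isPreconnected).image _ (by fun_prop)

/-- The map `z ↦ z d/dz`, which lowers the order of the polylogarithm by one, acts on functions of
`y = -z / (1 - z)` as `y (1 - y) d/dy`. -/
theorem isPolylog_bernoulliCumulantPoly (n : ℕ) :
    IsPolylog (-(n : ℂ)) fun z => -aeval (-z / (1 - z)) (bernoulliCumulantPoly n) := by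
  have hder : ∀ (n : ℕ) (z : ℂ), 1 - z ≠ 0 →
      HasDerivAt (fun z : ℂ => -aeval (-z / (1 - z)) (bernoulliCumulantPoly n))
        (-(aeval (-z / (1 - z)) (derivative (bernoulliCumulantPoly n)) *
          (-1 / (1 - z) ^ 2))) z := by
    intro n z hz
    have h1 : HasDerivAt (fun z : ℂ => -z / (1 - z)) (-1 / (1 - z) ^ 2) z := by
      have := (hasDerivAt_id z).neg.div ((hasDerivAt_id z).const_sub 1) hz
      refine this.congr_deriv ?_
      congr 1
      simp
    exact (((bernoulliCumulantPoly n).hasDerivAt_aeval (-z / (1 - z))).comp z h1).neg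
  have hderiv : ∀ (n : ℕ) (z : ℂ), 1 - z ≠ 0 →
      z * deriv (fun z : ℂ => -aeval (-z / (1 - z)) (bernoulliCumulantPoly n)) z
        = -aeval (-z / (1 - z)) (bernoulliCumulantPoly (n + 1)) := by
    intro n z hz
    rw [(hder n z hz).deriv]
    simp only [bernoulliCumulantPoly, map_mul, map_sub, aeval_X, map_one]
    field_simp
    ring
  refine ⟨?_, ?_⟩
  · have hopen : IsOpen polylogDomain :=
      Complex.isOpen_slitPlane.preimage (by fun_prop : Continuous fun z : ℂ => 1 - z)
    refine DifferentiableOn.analyticOnNhd (fun z hz => ?_) hopen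
    exact (hder n z (Complex.slitPlane_ne_zero hz)).differentiableAt.differentiableWithinAt
  · have hne : ∀ z ∈ Metric.ball (0 : ℂ) 1, 1 - z ≠ 0 := by
      intro z hz h
      have : z = 1 := by linear_combination -h
      simp [this] at hz
    induction n with
    | zero =>
      intro z hz
      have hz' : ‖z‖ < 1 := by simpa using hz
      have := ((hasSum_geometric_of_norm_lt_one hz').mul_left z).tsum_eq
      simp only [polylogSeries, bernoulliCumulantPoly, aeval_X]
      rw [neg_div, neg_neg, div_eq_mul_inv, ← this]
      congr 1
      ext k
      simp [pow_succ']
    | succ n ih =>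
      intro z hz
      refine (hderiv n z (hne z hz)).symm.trans ?_
      have hev : (fun z : ℂ => -aeval (-z / (1 - z)) (bernoulliCumulantPoly n))
          =ᶠ[𝓝 z] polylog (-(n : ℂ)) := by
        filter_upwards [Metric.isOpen_ball.mem_nhds hz] with w hw
        exact (ih w hw).trans ((isPolylog_polylog_neg_nat n).2 w hw).symm
      have hev' : polylog (-(n : ℂ)) =ᶠ[𝓝 z] polylogSeries (-(n : ℂ)) := by
        filter_upwards [Metric.isOpen_ball.mem_nhds hz] with w hw
          using (isPolylog_polylog_neg_nat n).2 w hw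
      have hz' : ‖z‖ < 1 := by simpa using hz
      obtain ⟨r, hzr, hr1⟩ := exists_between hz'
      have hr0 : 0 ≤ r := (norm_nonneg z).trans hzr.le
      have hsum : Summable fun k : ℕ => ((k + 1 : ℕ) : ℝ) ^ n * r ^ (k + 1) :=
        (summable_nat_add_iff (f := fun k : ℕ => (k : ℝ) ^ n * r ^ k) 1).2
          (summable_pow_mul_geometric_of_norm_lt_one n
            (by rwa [Real.norm_eq_abs, abs_of_nonneg hr0]))
      have key := Complex.hasSum_deriv_of_summable_norm
        (F := fun (k : ℕ) (w : ℂ) => ((k : ℂ) + 1) ^ (-(-(n : ℂ))) * w ^ (k + 1))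
        (U := Metric.ball 0 r) hsum
        (fun k => (by fun_prop : Differentiable ℂ _).differentiableOn) Metric.isOpen_ball
        (fun k w hw => by
          have hw' : ‖w‖ ≤ r := by simpa using (Metric.mem_ball.1 hw).le
          have hk : ‖((k : ℂ) + 1)‖ = (k : ℝ) + 1 := by
            rw [← Nat.cast_add_one, Complex.norm_natCast]; simp
          rw [neg_neg, Complex.cpow_natCast, norm_mul, norm_pow, norm_pow, hk]
          push_cast
          gcongr)
        (by simpa using hzr : z ∈ Metric.ball (0 : ℂ) r)
      rw [(hev.trans hev').deriv_eq]
      have hd : deriv (polylogSeries (-(n : ℂ))) z = _ := key.tsum_eq.symm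
      rw [hd, polylogSeries, ← tsum_mul_left]
      congr 1
      ext k
      have hd' : deriv (fun w : ℂ => ((k : ℂ) + 1) ^ (-(-(n : ℂ))) * w ^ (k + 1)) z
          = ((k : ℂ) + 1) ^ (-(-(n : ℂ))) * (((k : ℂ) + 1) * z ^ k) := by
        rw [deriv_const_mul_field, deriv_pow_field]
        push_cast
        simp
      rw [hd', neg_neg, neg_neg, Complex.cpow_natCast, Complex.cpow_natCast]
      ring

theorem polylog_neg_nat (n : ℕ) {z : ℂ} (hz : z ∈ polylogDomain) :
    polylog (-(n : ℂ)) z = -aeval (-z / (1 - z)) (bernoulliCumulantPoly n) := by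
  have h1 := isPolylog_polylog_neg_nat n
  have h2 := isPolylog_bernoulliCumulantPoly n
  refine h1.1.eqOn_of_preconnected_of_eventuallyEq h2.1 isPreconnected_polylogDomain
    (z₀ := 0) (by simp [polylogDomain]) ?_ hz
  filter_upwards [Metric.ball_mem_nhds (0 : ℂ) one_pos] with w hw
  exact (h1.2 w hw).trans (h2.2 w hw).symm

/-! ### The complementary error function -/

theorem integrable_exp_neg_abs : Integrable fun t : ℝ => Real.exp (-|t|) := by
  rw [← integrableOn_univ, ← Set.Iic_union_Ioi (a := (0 : ℝ)), integrableOn_union]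
  constructor
  · refine (integrableOn_exp_Iic 0).congr_fun (fun t ht => ?_) measurableSet_Iic
    rw [abs_of_nonpos ht, neg_neg]
  · refine (integrableOn_exp_neg_Ioi 0).congr_fun (fun t ht => ?_) measurableSet_Ioi
    rw [abs_of_pos ht]

theorem integrable_exp_neg_sq : Integrable fun t : ℝ => Real.exp (-t ^ 2) := by
  simpa using integrable_exp_neg_mul_sq one_pos

theorem erfc_add_erfc_neg (x : ℝ) : erfc x + erfc (-x) = 2 := by
  have h1 : ∫ t in Set.Ioi (-x), Real.exp (-t ^ 2) = ∫ t in Set.Iic x, Real.exp (-t ^ 2) := by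
    have := integral_comp_neg_Ioi (-x) (fun t : ℝ => Real.exp (-t ^ 2))
    simpa using this
  have h2 := integral_add_compl (μ := volume) (measurableSet_Ioi (a := x)) integrable_exp_neg_sq
  have h3 : ∫ t : ℝ, Real.exp (-t ^ 2) = √Real.pi := by simpa using integral_gaussian 1
  rw [Set.compl_Ioi, h3] at h2
  have : √Real.pi ≠ 0 := by positivity
  rw [erfc, erfc, h1, ← mul_add, h2]
  field_simp

theorem erfc_pos (x : ℝ) : 0 < erfc x := by
  refine mul_pos (by positivity) ?_
  rw [setIntegral_pos_iff_support_of_nonneg_ae (ae_of_all _ fun t => (Real.exp_pos _).le)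
    integrable_exp_neg_sq.integrableOn]
  have : Function.support (fun t : ℝ => Real.exp (-t ^ 2)) = Set.univ := by
    ext t; simp [(Real.exp_pos _).ne']
  simp [this]

theorem antitone_erfc : Antitone erfc := by
  intro x y h
  refine mul_le_mul_of_nonneg_left ?_ (by positivity)
  exact setIntegral_mono_set integrable_exp_neg_sq.integrableOn
    (ae_of_all _ fun t => (Real.exp_pos _).le) (Set.Ioi_subset_Ioi h).eventuallyLE

theorem erfc_le (x : ℝ) : erfc x ≤ 2 / √Real.pi * Real.exp (1 / 4) * Real.exp (-x) := by
  rw [erfc, mul_assoc]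
  refine mul_le_mul_of_nonneg_left ?_ (by positivity)
  rw [← integral_exp_neg_Ioi x, ← integral_const_mul]
  refine setIntegral_mono integrable_exp_neg_sq.integrableOn
    ((integrableOn_exp_neg_Ioi x).const_mul _) fun t => ?_
  simp only
  rw [← Real.exp_add, Real.exp_le_exp]
  nlinarith [sq_nonneg (t - 1 / 2)]

theorem half_erfc_mem_Icc (x : ℝ) : erfc x / 2 ∈ Set.Icc (0 : ℝ) 1 := by
  have := erfc_pos x
  have := erfc_pos (-x)
  have := erfc_add_erfc_neg x
  constructor <;> linarith

theorem integrable_bernoulliCumulantPoly_erfc (n : ℕ) :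
    Integrable fun x => (bernoulliCumulantPoly (n + 1)).eval (erfc x / 2) := by
  obtain ⟨C, hC0, hC⟩ := exists_abs_eval_bernoulliCumulantPoly_le n
  have hm : Measurable erfc := antitone_erfc.measurable
  set K := 2 / √Real.pi * Real.exp (1 / 4)
  have hint : Integrable fun x : ℝ => C * K * Real.exp (-|x|) :=
    (integrable_exp_neg_abs).const_mul _
  refine hint.mono' ?_ (ae_of_all _ fun x => ?_)
  · exact ((bernoulliCumulantPoly (n + 1)).continuous.measurable.comp
      (hm.div_const 2)).aestronglyMeasurable
  · refine (hC _ (half_erfc_mem_Icc x)).trans ?_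
    rw [mul_assoc]
    refine mul_le_mul_of_nonneg_left ?_ hC0
    have h1 := erfc_pos x
    have h2 := erfc_pos (-x)
    have h3 := erfc_add_erfc_neg x
    rcases le_total 0 x with hx | hx
    · rw [abs_of_nonneg hx]
      have := erfc_le x
      nlinarith
    · rw [abs_of_nonpos hx, neg_neg]
      have := erfc_le (-x)
      rw [neg_neg] at this
      nlinarith

theorem polylogErfc_eq (n : ℕ) (x : ℝ) :
    polylogErfc (n + 1) x = -(bernoulliCumulantPoly n).eval (erfc (-x) / 2) := by
  have h1 := erfc_pos x
  have h2 := erfc_pos (-x)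
  have h3 := erfc_add_erfc_neg x
  have hs : (1 : ℂ) - ((n + 1 : ℕ) : ℂ) = -(n : ℂ) := by push_cast; ring
  rw [polylogErfc, hs, polylog_neg_nat]
  · have : -((-(erfc (-x) / erfc x) : ℝ) : ℂ) / (1 - ((-(erfc (-x) / erfc x) : ℝ) : ℂ))
        = ((erfc (-x) / 2 : ℝ) : ℂ) := by
      have h4 : erfc x - -erfc (-x) = 2 := by linarith
      norm_cast
      field_simp
      rw [h4]
    rw [this, ← Complex.coe_algebraMap, aeval_algebraMap_apply]
    simp
  · refine Or.inl ?_
    have : 0 < erfc (-x) / erfc x := by positivity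
    simp only [Complex.sub_re, Complex.one_re, Complex.ofReal_re]
    linarith

theorem neg_one_pow_mul_polylogErfc (n : ℕ) (x : ℝ) :
    (-1) ^ (n + 2 + 1) * polylogErfc (n + 2) x
      = (bernoulliCumulantPoly (n + 1)).eval (erfc x / 2) := by
  have h : erfc (-x) / 2 = 1 - erfc x / 2 := by linarith [erfc_add_erfc_neg x]
  rw [polylogErfc_eq, h, eval_one_sub_bernoulliCumulantPoly]
  rcases neg_one_pow_eq_or ℝ n with h | h <;> simp [pow_add, h]

theorem polylogErfc_neg (n : ℕ) (x : ℝ) :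
    polylogErfc (n + 2) (-x) = (-1) ^ n * polylogErfc (n + 2) x := by
  have h : erfc (-x) / 2 = 1 - erfc x / 2 := by linarith [erfc_add_erfc_neg x]
  rw [polylogErfc_eq, polylogErfc_eq, neg_neg, h, eval_one_sub_bernoulliCumulantPoly]
  rcases neg_one_pow_eq_or ℝ n with h | h <;> simp [h]

theorem integrable_polylogErfc (n : ℕ) : Integrable (polylogErfc (n + 2)) := by
  refine ((integrable_bernoulliCumulantPoly_erfc n).const_mul ((-1) ^ (n + 2 + 1))).congr
    (ae_of_all _ fun x => ?_)
  simp only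
  rw [← neg_one_pow_mul_polylogErfc, ← mul_assoc, ← pow_add, Even.neg_one_pow (by simp), one_mul]

theorem bulkCumulant_eq (n : ℕ) :
    bulkCumulant (n + 2) = ∫ x, (bernoulliCumulantPoly (n + 1)).eval (erfc x / 2) := by
  simp_rw [bulkCumulant, ← neg_one_pow_mul_polylogErfc, integral_const_mul]

theorem edgeCumulant_eq (n : ℕ) (S : ℝ) :
    edgeCumulant (n + 2) S
      = ∫ x in Set.Iic S, (bernoulliCumulantPoly (n + 1)).eval (erfc x / 2) := by
  simp_rw [edgeCumulant, ← neg_one_pow_mul_polylogErfc, integral_const_mul]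

theorem bulkCumulant_of_odd {n : ℕ} (h : Odd n) : bulkCumulant (n + 2) = 0 := by
  have h1 := integral_neg_eq_self (polylogErfc (n + 2)) volume
  simp_rw [polylogErfc_neg, integral_const_mul, h.neg_one_pow] at h1
  have : ∫ x, polylogErfc (n + 2) x = 0 := by linarith
  rw [bulkCumulant, this, mul_zero]

end

/-! ### The Laplacian of a radial function -/

open RealInnerProductSpace in
theorem quarterLaplacian_radialPotential {g : ℝ → ℝ} (hg : DifferentiableOn ℝ g (Set.Ioi 0))
    (hg' : DifferentiableOn ℝ (deriv g) (Set.Ioi 0)) {r : ℝ} (hr : 0 < r) :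
    quarterLaplacian (radialPotential g) (r : ℂ)
      = 1 / 4 * (deriv (deriv g) r + deriv g r / r) := by
  have hnorm : ∀ z : ℂ, z ≠ 0 →
      HasFDerivAt (fun w : ℂ => ‖w‖) ((1 / ‖z‖) • innerSL ℝ z) z := by
    intro z hz
    have hz' : 0 < ‖z‖ := norm_pos_iff.2 hz
    have h3 : HasFDerivAt (fun w : ℂ => √(‖w‖ ^ 2)) _ z :=
      (hasStrictFDerivAt_norm_sq z).hasFDerivAt.sqrt (by positivity)
    simp only [Real.sqrt_sq (norm_nonneg _)] at h3
    convert h3 using 1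
    ext v
    simp
    field_simp
  have hd : ∀ z : ℂ, z ≠ 0 → HasFDerivAt (radialPotential g)
      ((deriv g ‖z‖ / ‖z‖) • innerSL ℝ z) z := by
    intro z hz
    have hz' : 0 < ‖z‖ := norm_pos_iff.2 hz
    have h1 : HasDerivAt g (deriv g ‖z‖) ‖z‖ :=
      (hg.differentiableAt (Ioi_mem_nhds hz')).hasDerivAt
    have h4 := h1.comp_hasFDerivAt z (hnorm z hz)
    rw [smul_smul, mul_one_div] at h4
    exact h4
  have hr0 : (r : ℂ) ≠ 0 := by exact_mod_cast hr.ne'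
  have hnr : ‖(r : ℂ)‖ = r := by simp [abs_of_pos hr]
  have hev : fderiv ℝ (radialPotential g)
      =ᶠ[𝓝 (r : ℂ)] fun z => (deriv g ‖z‖ / ‖z‖) • innerSL ℝ z := by
    filter_upwards [isOpen_compl_singleton.mem_nhds hr0] with z hz using (hd z hz).fderiv
  have hpsi : HasDerivAt (fun ρ => deriv g ρ / ρ)
      ((deriv (deriv g) r * r - deriv g r * 1) / r ^ 2) r :=
    (hg'.differentiableAt (Ioi_mem_nhds hr)).hasDerivAt.div (hasDerivAt_id r) hr.ne'
  have h1 : HasFDerivAt (fun z : ℂ => deriv g ‖z‖ / ‖z‖) _ (r : ℂ) :=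
    (by rw [hnr]; exact hpsi : HasDerivAt (fun ρ => deriv g ρ / ρ)
      ((deriv (deriv g) r * r - deriv g r * 1) / r ^ 2) ‖(r : ℂ)‖).comp_hasFDerivAt
      (r : ℂ) (hnorm _ hr0)
  have h2 := h1.smul (innerSL ℝ (E := ℂ)).hasFDerivAt
  rw [quarterLaplacian, InnerProductSpace.laplacian_eq_iteratedFDeriv_complexPlane]
  simp only [iteratedFDeriv_two_apply, hev.fderiv_eq]
  erw [h2.fderiv]
  have e1 : (innerSL ℝ (1 : ℂ)) (1 : ℂ) = 1 := by rw [innerSL_apply_apply]; simp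
  have e2 : (innerSL ℝ Complex.I) Complex.I = 1 := by rw [innerSL_apply_apply]; simp
  have e3 : (innerSL ℝ (r : ℂ)) (1 : ℂ) = r := by rw [innerSL_apply_apply]; simp
  have e4 : (innerSL ℝ (r : ℂ)) Complex.I = 0 := by rw [innerSL_apply_apply]; simp
  simp [e1, e2, e3, e4, abs_of_pos hr]
  field_simp
  ring

/-- In polar coordinates the Laplacian of `g(|z|)` is `(r g')' / r`. -/
theorem hasDerivAt_mul_deriv {g : ℝ → ℝ} (hg : DifferentiableOn ℝ g (Set.Ioi 0))
    (hg' : DifferentiableOn ℝ (deriv g) (Set.Ioi 0)) {r : ℝ} (hr : 0 < r) :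
    HasDerivAt (fun r => r * deriv g r)
      (4 * r * quarterLaplacian (radialPotential g) (r : ℂ)) r := by
  refine ((hasDerivAt_id r).mul
    (hg'.differentiableAt (Ioi_mem_nhds hr)).hasDerivAt).congr_deriv ?_
  rw [quarterLaplacian_radialPotential hg hg' hr]
  simp only [id]
  field_simp
  ring

/-! ### First-order expansion uniform in the index -/

/-- If the derivatives of `q N` converge locally uniformly, then `q N` has a first-order expansion
at each point with an error uniform in `N`. The limit of the derivatives is not assumed to be
continuous: the expansion of a single `q M` with large `M` is used, and `q N - q M` has small
derivative. -/
theorem exists_uniform_linear_approx {q q' : ℕ → ℝ → ℝ} {L : ℝ → ℝ} {U : Set ℝ} (hU : IsOpen U)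
    (hq : ∀ᶠ N in atTop, ∀ r ∈ U, HasDerivAt (q N) (q' N r) r)
    (hL : TendstoLocallyUniformlyOn q' L atTop U) {α : ℝ} (hα : α ∈ U) {ε : ℝ} (hε : 0 < ε) :
    ∃ δ > 0, ∀ᶠ N in atTop, ∀ r, |r - α| < δ →
      |q N r - q N α - L α * (r - α)| ≤ ε * |r - α| := by
  have hε4 : 0 < ε / 4 := by positivity
  obtain ⟨t, ht, hN⟩ := Metric.tendstoLocallyUniformlyOn_iff.1 hL (ε / 4) hε4 α hα
  rw [hU.nhdsWithin_eq hα] at ht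
  obtain ⟨M, hMt, hMq⟩ := (hN.and hq).exists
  have hM := hasDerivAt_iff_isLittleO.1 (hMq α hα)
  have hM' := hM.def hε4
  obtain ⟨δ, hδ, hball⟩ := Metric.mem_nhds_iff.1
    (Filter.inter_mem (Filter.inter_mem ht (hU.mem_nhds hα)) hM')
  refine ⟨δ, hδ, ?_⟩
  filter_upwards [hN, hq] with N hNt hNq r hr
  have hconv := convex_ball α δ
  have hαb : α ∈ Metric.ball α δ := Metric.mem_ball_self hδ
  have hrb : r ∈ Metric.ball α δ := by rwa [Metric.mem_ball, Real.dist_eq]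
  have hdiff := hconv.norm_image_sub_le_of_norm_hasDerivWithin_le
    (f := fun x => q N x - q M x) (f' := fun x => q' N x - q' M x) (C := ε / 2)
    (fun x hx => ((hNq x (hball hx).1.2).sub (hMq x (hball hx).1.2)).hasDerivWithinAt)
    (fun x hx => by
      have h1 := hNt x (hball hx).1.1
      have h2 := hMt x (hball hx).1.1
      rw [Real.dist_eq] at h1 h2
      rw [Real.norm_eq_abs]
      have := abs_sub_le (q' N x) (L x) (q' M x)
      rw [abs_sub_comm (q' N x) (L x)] at this
      linarith) hαb hrb
  have h3 := (hball hrb).2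
  have h4 := hMt α (hball hαb).1.1
  simp only [Set.mem_ofPred_eq, smul_eq_mul, Real.norm_eq_abs, Real.dist_eq] at h3 h4 hdiff
  have h5 : q N r - q N α - L α * (r - α)
      = (q N r - q M r - (q N α - q M α)) + (q M r - q M α - (r - α) * q' M α)
        + -((L α - q' M α) * (r - α)) := by ring
  rw [h5]
  refine (abs_add_three _ _ _).trans ?_
  rw [abs_neg, abs_mul]
  have := mul_le_mul_of_nonneg_right h4.le (abs_nonneg (r - α))
  linarith

/-- A uniform first-order expansion at `α` transfers limits along points whose rescaled distance to
`α` converges. -/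
theorem tendsto_mul_sub_of_uniform_linear_approx {q : ℕ → ℝ → ℝ} {α κ ρ : ℝ}
    (h : ∀ ε > 0, ∃ δ > 0, ∀ᶠ N in atTop, ∀ r, |r - α| < δ →
      |q N r - q N α - κ * (r - α)| ≤ ε * |r - α|)
    {l r : ℕ → ℝ} (hl : Tendsto l atTop atTop)
    (hr : Tendsto (fun N => l N * (r N - α)) atTop (𝓝 ρ)) :
    Tendsto (fun N => l N * (q N (r N) - q N α)) atTop (𝓝 (κ * ρ)) := by
  have hr0 : Tendsto (fun N => r N - α) atTop (𝓝 0) := by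
    have := hl.inv_tendsto_atTop.mul hr
    rw [zero_mul] at this
    refine this.congr' ?_
    filter_upwards [hl.eventually_gt_atTop 0] with N hN
    simp only [Pi.inv_apply]
    field_simp
  have hz : Tendsto (fun N => l N * (q N (r N) - q N α - κ * (r N - α))) atTop (𝓝 0) := by
    rw [Metric.tendsto_nhds]
    intro ε hε
    obtain ⟨δ, hδ, hN⟩ := h (ε / (2 * (|ρ| + 1))) (by positivity)
    filter_upwards [hN, hl.eventually_gt_atTop 0,
      Metric.tendsto_nhds.1 hr0 δ hδ, hr.abs.eventually_lt_const (lt_add_one |ρ|)]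
      with N hN hlN hrN hρ
    rw [Real.dist_eq, sub_zero] at hrN ⊢
    rw [abs_mul, abs_of_pos hlN] at hρ ⊢
    calc l N * |q N (r N) - q N α - κ * (r N - α)|
        ≤ l N * (ε / (2 * (|ρ| + 1)) * |r N - α|) :=
          mul_le_mul_of_nonneg_left (hN _ hrN) hlN.le
      _ = ε / (2 * (|ρ| + 1)) * (l N * |r N - α|) := by ring
      _ ≤ ε / (2 * (|ρ| + 1)) * (|ρ| + 1) := by gcongr
      _ = ε / 2 := by field_simp
      _ < ε := by linarith
  have := hz.add (hr.const_mul κ)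
  rw [zero_add] at this
  refine this.congr fun N => ?_
  ring

/-! ### Exponentially tilted log-concave weights -/

/-- A convex function on the line with minimal value `0`, attained at `0`. -/
structure IsConvexWell (Γ : ℝ → ℝ) : Prop where
  convexOn : ConvexOn ℝ Set.univ Γ
  map_zero : Γ 0 = 0
  nonneg : ∀ s, 0 ≤ Γ s

/-- The mass that the probability measure with density proportional to `exp (y s - Γ s)` gives to
the half-line `s ≤ 0`. -/
noncomputable def tiltedProb (Γ : ℝ → ℝ) (y : ℝ) : ℝ :=
  (∫ s in Set.Iic 0, Real.exp (y * s - Γ s)) / ∫ s, Real.exp (y * s - Γ s)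

theorem tiltedProb_mem_Icc (Γ : ℝ → ℝ) (y : ℝ) : tiltedProb Γ y ∈ Set.Icc (0 : ℝ) 1 := by
  have h1 : 0 ≤ ∫ s in Set.Iic 0, Real.exp (y * s - Γ s) :=
    integral_nonneg fun _ => (Real.exp_pos _).le
  refine ⟨div_nonneg h1 (integral_nonneg fun _ => (Real.exp_pos _).le), ?_⟩
  by_cases hi : Integrable fun s => Real.exp (y * s - Γ s)
  · refine div_le_one_of_le₀ ?_ (integral_nonneg fun _ => (Real.exp_pos _).le)
    exact setIntegral_le_integral hi (ae_of_all _ fun _ => (Real.exp_pos _).le)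
  · rw [tiltedProb, integral_undef hi, div_zero]
    exact zero_le_one

theorem tiltedProb_comp_neg {Γ : ℝ → ℝ} {y : ℝ}
    (hi : Integrable fun s => Real.exp (y * s - Γ s)) :
    tiltedProb (fun s => Γ (-s)) (-y) = 1 - tiltedProb Γ y := by
  have hpos := integral_exp_pos hi
  have h1 : ∫ s in Set.Iic 0, Real.exp (-y * s - Γ (-s))
      = ∫ s in Set.Ioi 0, Real.exp (y * s - Γ s) := by
    have := integral_comp_neg_Iic (0 : ℝ) (fun s : ℝ => Real.exp (y * s - Γ s))
    simpa using this
  have h2 : ∫ s, Real.exp (-y * s - Γ (-s)) = ∫ s, Real.exp (y * s - Γ s) := by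
    have := integral_neg_eq_self (fun s : ℝ => Real.exp (y * s - Γ s)) volume
    simpa using this
  have h3 := integral_add_compl (μ := volume) (measurableSet_Iic (a := (0 : ℝ))) hi
  rw [Set.compl_Iic] at h3
  rw [tiltedProb, tiltedProb, h1, h2, eq_sub_iff_add_eq, ← add_div, add_comm, h3,
    div_self hpos.ne']

namespace IsConvexWell

theorem comp_neg {Γ : ℝ → ℝ} (h : IsConvexWell Γ) : IsConvexWell fun s => Γ (-s) where
  convexOn := by
    have := h.convexOn.comp_linearMap (-LinearMap.id : ℝ →ₗ[ℝ] ℝ)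
    rw [Set.preimage_univ] at this
    exact this
  map_zero := by simp [h.map_zero]
  nonneg s := h.nonneg _

theorem continuous {Γ : ℝ → ℝ} (h : IsConvexWell Γ) : Continuous Γ :=
  continuousOn_univ.1 (h.convexOn.continuousOn isOpen_univ)

/-- Convexity and `Γ 0 = 0` make `Γ` star-shaped. -/
theorem map_mul_le {Γ : ℝ → ℝ} (h : IsConvexWell Γ) {t : ℝ} (ht : t ∈ Set.Icc (0 : ℝ) 1) (s : ℝ) :
    Γ (t * s) ≤ t * Γ s := by
  have := h.convexOn.2 (Set.mem_univ s) (Set.mem_univ 0) ht.1 (by linarith [ht.2] : 0 ≤ 1 - t)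
    (by ring)
  simpa [h.map_zero] using this

/-- Bounds at `± R` propagate outwards as linear lower bounds. -/
theorem mul_le_of_le {Γ : ℝ → ℝ} (h : IsConvexWell Γ) {R K : ℝ} (hR : 0 < R)
    (h1 : K * R ≤ Γ R) (h2 : K * R ≤ Γ (-R)) {s : ℝ} (hs : R ≤ |s|) : K * |s| ≤ Γ s := by
  have hs0 : 0 < |s| := hR.trans_le hs
  have ht : R / |s| ∈ Set.Icc (0 : ℝ) 1 := ⟨by positivity, div_le_one_of_le₀ hs hs0.le⟩
  have h3 := h.map_mul_le ht s
  have h4 : K * R ≤ R / |s| * Γ s := by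
    rcases abs_cases s with ⟨ha, hb⟩ | ⟨ha, hb⟩
    · have : R / |s| * s = R := by rw [ha] at hs0 ⊢; field_simp
      rw [this] at h3
      linarith
    · have : R / |s| * s = -R := by
        rw [ha] at hs0 ⊢
        have : s ≠ 0 := hb.ne
        field_simp
      rw [this] at h3
      linarith
  have h5 : K * R * |s| ≤ R * Γ s := by
    have := mul_le_mul_of_nonneg_right h4 hs0.le
    calc K * R * |s| ≤ R / |s| * Γ s * |s| := this
      _ = R * Γ s := by field_simp
  have : R * (K * |s|) ≤ R * Γ s := by linarith
  exact le_of_mul_le_mul_left this hR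

/-- Exponential decay in the tilt: on `s ≤ 0` the weight is at most `exp (y s)`, while on `[0, 1]`
it is at least `exp (y s - C)`. -/
theorem tiltedProb_le {Γ : ℝ → ℝ} (h : IsConvexWell Γ) {C : ℝ} (hC0 : 0 ≤ C) (hC : Γ 1 ≤ C) {y : ℝ}
    (hi : Integrable fun s => Real.exp (y * s - Γ s)) :
    tiltedProb Γ y ≤ 3 * Real.exp C * Real.exp (-y) := by
  have hC1 : 1 ≤ Real.exp C := Real.one_le_exp hC0
  rcases le_or_gt y 1 with hy | hy
  · refine (tiltedProb_mem_Icc Γ y).2.trans ?_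
    have h1 : Real.exp (-1) ≤ Real.exp (-y) := Real.exp_le_exp.2 (by linarith)
    have h2 : 1 / 3 ≤ Real.exp (-1) := by
      rw [Real.exp_neg, ← one_div]
      exact one_div_le_one_div_of_le (Real.exp_pos _) (by linarith [Real.exp_one_lt_d9])
    nlinarith
  · have hy0 : 0 < y := by linarith
    have hnum : ∫ s in Set.Iic 0, Real.exp (y * s - Γ s) ≤ 1 / y := by
      have h1 : ∫ s in Set.Iic (0 : ℝ), Real.exp (y * s) = 1 / y := by
        rw [integral_exp_mul_Iic hy0]; simp
      rw [← h1]
      refine setIntegral_mono hi.integrableOn (integrableOn_exp_mul_Iic hy0 0) fun s => ?_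
      exact Real.exp_le_exp.2 (by linarith [h.nonneg s])
    have hden : Real.exp (-C) * ((Real.exp y - 1) / y) ≤ ∫ s, Real.exp (y * s - Γ s) := by
      have h1 : ∫ s in (0 : ℝ)..1, Real.exp (y * s) = (Real.exp y - 1) / y := by
        rw [intervalIntegral.integral_comp_mul_left (fun s => Real.exp s) hy0.ne']
        simp
        ring
      rw [← h1, ← intervalIntegral.integral_const_mul,
        intervalIntegral.integral_of_le zero_le_one]
      refine le_trans ?_ (setIntegral_le_integral (s := Set.Ioc 0 1) hi
        (ae_of_all _ fun _ => (Real.exp_pos _).le))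
      refine setIntegral_mono_on (Continuous.integrableOn_Ioc (by fun_prop)) hi.integrableOn
        measurableSet_Ioc fun s hs => ?_
      rw [← Real.exp_add, Real.exp_le_exp]
      have := h.map_mul_le ⟨hs.1.le, hs.2⟩ 1
      rw [mul_one] at this
      nlinarith [hs.1, hs.2, h.nonneg 1]
    have hey : Real.exp y / 2 ≤ Real.exp y - 1 := by
      have := Real.add_one_le_exp y
      linarith
    have hden' : Real.exp (-C) * (Real.exp y / 2 / y) ≤ ∫ s, Real.exp (y * s - Γ s) := by
      refine le_trans ?_ hden
      gcongr
    rw [tiltedProb, div_le_iff₀ (integral_exp_pos hi)]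
    refine hnum.trans ?_
    have : 1 / y ≤ 3 * Real.exp C * Real.exp (-y) * (Real.exp (-C) * (Real.exp y / 2 / y)) := by
      rw [Real.exp_neg, Real.exp_neg]
      field_simp
      norm_num
    refine this.trans ?_
    gcongr

theorem tiltedProb_mul_le {Γ : ℝ → ℝ} (h : IsConvexWell Γ) {C : ℝ} (hC0 : 0 ≤ C) (hC1 : Γ 1 ≤ C)
    (hC2 : Γ (-1) ≤ C) {y : ℝ} (hi : Integrable fun s => Real.exp (y * s - Γ s)) :
    tiltedProb Γ y * (1 - tiltedProb Γ y) ≤ 3 * Real.exp C * Real.exp (-|y|) := by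
  have hm := tiltedProb_mem_Icc Γ y
  have h1 := h.tiltedProb_le hC0 hC1 hi
  have hi' : Integrable fun s => Real.exp (-y * s - Γ (-s)) := by
    simpa using hi.comp_neg
  have h2 := h.comp_neg.tiltedProb_le hC0 hC2 hi'
  rw [tiltedProb_comp_neg hi, neg_neg] at h2
  rcases abs_cases y with ⟨ha, -⟩ | ⟨ha, -⟩
  · rw [ha]
    nlinarith [hm.1, hm.2]
  · rw [ha, neg_neg]
    nlinarith [hm.1, hm.2]

end IsConvexWell

/-! ### Convergence to a Gaussian weight -/

theorem setIntegral_gaussian_Iic {c : ℝ} (hc : 0 < c) (y : ℝ) :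
    (∫ s in Set.Iic 0, Real.exp (y * s - c * s ^ 2 / 2)) / ∫ s, Real.exp (y * s - c * s ^ 2 / 2)
      = erfc (y / √(2 * c)) / 2 := by
  have hsq : √(c / 2) ≠ 0 := by positivity
  have key : ∀ F : ℝ → ℝ, ∫ s, F (√(c / 2) * (s - y / c)) = (√(c / 2))⁻¹ * ∫ v, F v := by
    intro F
    rw [integral_sub_right_eq_self (fun s => F (√(c / 2) * s)) (y / c),
      Measure.integral_comp_mul_left, abs_of_nonneg (by positivity), smul_eq_mul]
  -- completing the square
  have hf : ∀ s, Real.exp (y * s - c * s ^ 2 / 2)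
      = Real.exp (y ^ 2 / (2 * c)) * Real.exp (-(√(c / 2) * (s - y / c)) ^ 2) := by
    intro s
    rw [← Real.exp_add, mul_pow, Real.sq_sqrt (by positivity)]
    congr 1
    field_simp
    ring
  have hden : ∫ s, Real.exp (y * s - c * s ^ 2 / 2)
      = Real.exp (y ^ 2 / (2 * c)) * ((√(c / 2))⁻¹ * √Real.pi) := by
    simp_rw [hf]
    rw [integral_const_mul, key fun v => Real.exp (-v ^ 2)]
    congr 2
    simpa using integral_gaussian 1
  have hset : ∀ s, s ∈ Set.Iic (0 : ℝ)
      ↔ √(c / 2) * (s - y / c) ∈ Set.Iic (-(y / √(2 * c))) := by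
    intro s
    have h1 : y / √(2 * c) = √(c / 2) * (y / c) := by
      have h2 : √(2 * c) = 2 * √(c / 2) := by
        rw [show 2 * c = 2 ^ 2 * (c / 2) by ring, Real.sqrt_mul (by positivity),
          Real.sqrt_sq (by positivity)]
      have h3 : √(c / 2) ^ 2 = c / 2 := Real.sq_sqrt (by positivity)
      rw [h2]
      field_simp
      rw [h3]
      field_simp
    rw [Set.mem_Iic, Set.mem_Iic, h1, mul_sub]
    have : 0 < √(c / 2) := by positivity
    constructor
    · intro hs
      nlinarith
    · intro hs
      by_contra! h
      nlinarith [mul_pos this h]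
  have hnum : ∫ s in Set.Iic 0, Real.exp (y * s - c * s ^ 2 / 2)
      = Real.exp (y ^ 2 / (2 * c)) * ((√(c / 2))⁻¹ *
        ∫ t in Set.Ioi (y / √(2 * c)), Real.exp (-t ^ 2)) := by
    have h1 : ∫ t in Set.Ioi (y / √(2 * c)), Real.exp (-t ^ 2)
        = ∫ t, (Set.Iic (-(y / √(2 * c)))).indicator (fun t => Real.exp (-t ^ 2)) t := by
      rw [integral_indicator measurableSet_Iic]
      have := integral_comp_neg_Ioi (y / √(2 * c)) (fun t : ℝ => Real.exp (-t ^ 2))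
      simpa using this
    rw [h1, ← key, ← integral_const_mul, ← integral_indicator measurableSet_Iic]
    refine integral_congr_ae (ae_of_all _ fun s => ?_)
    by_cases hs : s ∈ Set.Iic (0 : ℝ)
    · simp only [Set.indicator_of_mem hs, Set.indicator_of_mem ((hset s).1 hs), hf]
    · simp only [Set.indicator_of_notMem hs, Set.indicator_of_notMem fun h => hs ((hset s).2 h),
        mul_zero]
  rw [hnum, hden, erfc]
  have : √Real.pi ≠ 0 := by positivity
  field_simp

/-- Pointwise convergence of the convex exponents to a quadratic suffices: beyond a fixed radius `R`
convexity forces growth faster than the tilt, which gives an integrable bound. -/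
theorem tendsto_tiltedProb {Γ : ℕ → ℝ → ℝ} {c : ℝ} (hc : 0 < c)
    (hΓ : ∀ᶠ N in atTop, IsConvexWell (Γ N))
    (hlim : ∀ s, Tendsto (fun N => Γ N s) atTop (𝓝 (c * s ^ 2 / 2)))
    {y : ℝ} {v : ℕ → ℝ} (hv : Tendsto v atTop (𝓝 y)) :
    Tendsto (fun N => tiltedProb (Γ N) (v N)) atTop (𝓝 (erfc (y / √(2 * c)) / 2)) := by
  -- the slope of `c s ^ 2 / 2` between `0` and `R` is `c R / 2 = 2 (|y| + 2)`
  set R : ℝ := 4 * (|y| + 2) / c with hRdef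
  have hR : 0 < R := by positivity
  have hRc : (|y| + 2) * R < c * R ^ 2 / 2 := by
    have : (|y| + 2) = c * R / 4 := by rw [hRdef]; field_simp
    rw [this]
    nlinarith [mul_pos hc (mul_pos hR hR)]
  have hbound : ∀ᶠ N in atTop, ∀ s,
      ‖Real.exp (v N * s - Γ N s)‖ ≤ Real.exp ((|y| + 2) * R) * Real.exp (-|s|) := by
    filter_upwards [hΓ, (hlim R).eventually_const_lt hRc,
      (hlim (-R)).eventually_const_lt (by rwa [neg_sq]),
      hv.abs.eventually_lt_const (lt_add_one |y|)] with N hN h1 h2 h3 s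
    rw [Real.norm_of_nonneg (Real.exp_pos _).le, ← Real.exp_add, Real.exp_le_exp]
    have h4 : v N * s ≤ (|y| + 1) * |s| := by
      refine (le_abs_self _).trans ?_
      rw [abs_mul]
      gcongr
    have hy := abs_nonneg y
    rcases le_total R |s| with hs | hs
    · have := hN.mul_le_of_le hR h1.le h2.le hs
      have : 0 ≤ (|y| + 2) * R := by positivity
      linarith
    · have := hN.nonneg s
      nlinarith [abs_nonneg s]
  have hmeas : ∀ᶠ N in atTop, AEStronglyMeasurable (fun s => Real.exp (v N * s - Γ N s)) := by
    filter_upwards [hΓ] with N hN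
    have := hN.continuous
    exact (by fun_prop : Continuous fun s => Real.exp (v N * s - Γ N s)).aestronglyMeasurable
  have hint : Integrable fun s : ℝ => Real.exp ((|y| + 2) * R) * Real.exp (-|s|) :=
    integrable_exp_neg_abs.const_mul _
  have hpt : ∀ s, Tendsto (fun N => Real.exp (v N * s - Γ N s)) atTop
      (𝓝 (Real.exp (y * s - c * s ^ 2 / 2))) := fun s =>
    (Real.continuous_exp.tendsto _).comp ((hv.mul_const s).sub (hlim s))
  rw [← setIntegral_gaussian_Iic hc]
  refine Tendsto.div ?_ ?_ ?_
  · refine tendsto_integral_filter_of_dominated_convergence _ ?_ ?_ hint.integrableOn ?_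
    · filter_upwards [hmeas] with N hN using hN.restrict
    · filter_upwards [hbound] with N hN using ae_of_all _ hN
    · exact ae_of_all _ hpt
  · refine tendsto_integral_filter_of_dominated_convergence _ hmeas ?_ hint ?_
    · filter_upwards [hbound] with N hN using ae_of_all _ hN
    · exact ae_of_all _ hpt
  · have hi : Integrable fun s => Real.exp (y * s - c * s ^ 2 / 2) := by
      refine hint.mono' (by fun_prop) (ae_of_all _ fun s => ?_)
      exact le_of_tendsto (hpt s).norm (hbound.mono fun N hN => hN s)
    exact (integral_exp_pos hi).ne'

/-! ### Riemann sums -/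

/-- The tilt `(4 k - N Q) / √N` of the weight of index `k`, where `Q = a g'(a)` on the circle of
radius `a`. As `k` varies these form a grid of mesh `4 / √N`. -/
noncomputable def saddleGrid (N : ℕ) (Q k : ℝ) : ℝ := (4 * k - N * Q) / √N

theorem saddleGrid_le_iff {N : ℕ} (hN : 0 < N) {Q k y : ℝ} :
    y ≤ saddleGrid N Q k ↔ (√N * y + N * Q) / 4 ≤ k := by
  have : 0 < √(N : ℝ) := by positivity
  rw [saddleGrid, le_div_iff₀ this, div_le_iff₀ (by norm_num)]
  constructor <;> intro h <;> linarith

theorem saddleGrid_sub_one (N : ℕ) (Q k : ℝ) :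
    saddleGrid N Q (k - 1) = saddleGrid N Q k - 4 / √N := by
  rw [saddleGrid, saddleGrid, ← sub_div]
  ring

/-- The step function that equals `b k` between the grid points of index `k - 1` and `k`, and `0`
outside the grid. -/
noncomputable def gridStep (N : ℕ) (Q : ℝ) (b : ℕ → ℝ) (y : ℝ) : ℝ :=
  ∑ k ∈ Finset.Icc 1 N,
    (Set.Ioc (saddleGrid N Q ((k : ℝ) - 1)) (saddleGrid N Q k)).indicator (fun _ => b k) y

theorem integral_gridStep {N : ℕ} (hN : 0 < N) (Q : ℝ) (b : ℕ → ℝ) :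
    ∫ y, gridStep N Q b y = 4 / √N * ∑ k ∈ Finset.Icc 1 N, b k := by
  have h0 : 0 ≤ 4 / √(N : ℝ) := by positivity
  simp only [gridStep]
  rw [integral_finsetSum, Finset.mul_sum]
  · refine Finset.sum_congr rfl fun k _ => ?_
    rw [integral_indicator measurableSet_Ioc, setIntegral_const, measureReal_def, Real.volume_Ioc,
      saddleGrid_sub_one, sub_sub_cancel, ENNReal.toReal_ofReal h0, smul_eq_mul]
  · intro k _
    exact (integrable_indicator_iff measurableSet_Ioc).2 (by simp)

theorem measurable_gridStep (N : ℕ) (Q : ℝ) (b : ℕ → ℝ) : Measurable (gridStep N Q b) := by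
  unfold gridStep
  exact Finset.measurable_fun_sum _ fun k _ => measurable_const.indicator measurableSet_Ioc

theorem gridStep_eq_zero {N : ℕ} (hN : 0 < N) {Q : ℝ} {b : ℕ → ℝ} {y : ℝ}
    (hy : y ≤ saddleGrid N Q 0 ∨ saddleGrid N Q N < y) : gridStep N Q b y = 0 := by
  refine Finset.sum_eq_zero fun k hk => Set.indicator_of_notMem (fun h => ?_) _
  rw [Finset.mem_Icc] at hk
  have hk1 : (1 : ℝ) ≤ k := by exact_mod_cast hk.1
  have hk2 : (k : ℝ) ≤ N := by exact_mod_cast hk.2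
  have h1 := h.1
  have h2 := (saddleGrid_le_iff hN).1 h.2
  rw [← not_le, saddleGrid_le_iff hN] at h1
  rcases hy with hy | hy
  · rw [saddleGrid_le_iff hN] at hy
    linarith
  · rw [← not_le, saddleGrid_le_iff hN] at hy
    linarith

theorem exists_gridStep_eq {N : ℕ} (hN : 0 < N) {Q : ℝ} (b : ℕ → ℝ) {y : ℝ}
    (hy : saddleGrid N Q 0 < y) (hy' : y ≤ saddleGrid N Q N) :
    ∃ k ∈ Finset.Icc 1 N, gridStep N Q b y = b k ∧ |saddleGrid N Q k - y| ≤ 4 / √N := by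
  rw [← not_le, saddleGrid_le_iff hN, not_le] at hy
  rw [saddleGrid_le_iff hN] at hy'
  set x := (√N * y + N * Q) / 4 with hx
  have hk1 : 1 ≤ ⌈x⌉₊ := Nat.one_le_iff_ne_zero.2 (Nat.ceil_pos.2 hy).ne'
  have hk2 : ⌈x⌉₊ ≤ N := Nat.ceil_le.2 hy'
  have hmem : ∀ k : ℕ, 1 ≤ k →
      (y ∈ Set.Ioc (saddleGrid N Q ((k : ℝ) - 1)) (saddleGrid N Q k) ↔ k = ⌈x⌉₊) := by
    intro k hk
    rw [Set.mem_Ioc, ← not_le, saddleGrid_le_iff hN, saddleGrid_le_iff hN, eq_comm,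
      Nat.ceil_eq_iff (by omega), not_le, Nat.cast_sub hk, Nat.cast_one]
  refine ⟨⌈x⌉₊, Finset.mem_Icc.2 ⟨hk1, hk2⟩, ?_, ?_⟩
  · rw [gridStep, Finset.sum_eq_single ⌈x⌉₊]
    · exact Set.indicator_of_mem ((hmem _ hk1).2 rfl) _
    · intro k hk hne
      exact Set.indicator_of_notMem (fun h => hne ((hmem k (Finset.mem_Icc.1 hk).1).1 h)) _
    · intro h
      exact absurd (Finset.mem_Icc.2 ⟨hk1, hk2⟩) h
  · have h := (hmem _ hk1).2 rfl
    rw [saddleGrid_sub_one] at h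
    rw [abs_le]
    constructor <;> linarith [h.1, h.2]

/-- A sum over the grid, divided by `√N`, converges to an integral. The set `A` collects the points
that the grid eventually reaches; points where this fails to be decided must form a null set. -/
theorem tendsto_sum_tiltedProb {Γ : ℕ → ℝ → ℝ} {Q : ℕ → ℝ} {c : ℝ} (hc : 0 < c)
    (hΓ : ∀ᶠ N in atTop, IsConvexWell (Γ N))
    (hlim : ∀ s, Tendsto (fun N => Γ N s) atTop (𝓝 (c * s ^ 2 / 2)))
    (hint : ∀ᶠ N : ℕ in atTop, ∀ k ∈ Finset.Icc 1 N,
      Integrable fun s => Real.exp (saddleGrid N (Q N) k * s - Γ N s))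
    {A : Set ℝ} (hA : MeasurableSet A)
    (hlow : ∀ y, ∀ᶠ N : ℕ in atTop, saddleGrid N (Q N) 0 < y)
    (hup : ∀ᵐ y : ℝ, (y ∈ A ∧ ∀ᶠ N : ℕ in atTop, y ≤ saddleGrid N (Q N) N) ∨
      (y ∉ A ∧ ∀ᶠ N : ℕ in atTop, saddleGrid N (Q N) N < y))
    {f : ℝ → ℝ} (hf : Continuous f) {C : ℝ} (hC : 0 ≤ C)
    (hfC : ∀ x ∈ Set.Icc (0 : ℝ) 1, |f x| ≤ C * (x * (1 - x))) :
    Tendsto (fun N : ℕ => (√N)⁻¹ *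
        ∑ k ∈ Finset.Icc 1 N, f (tiltedProb (Γ N) (saddleGrid N (Q N) k))) atTop
      (𝓝 (1 / 4 * ∫ y in A, f (erfc (y / √(2 * c)) / 2))) := by
  set F : ℕ → ℝ → ℝ := fun N =>
    gridStep N (Q N) fun k => f (tiltedProb (Γ N) (saddleGrid N (Q N) k)) with hF
  have hmesh : Tendsto (fun N : ℕ => 4 / √(N : ℝ)) atTop (𝓝 0) :=
    (Real.tendsto_sqrt_atTop.comp tendsto_natCast_atTop_atTop).const_div_atTop 4
  have hC' : 0 < c + 1 := by positivity
  have hbound : ∀ᶠ N in atTop, ∀ y,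
      ‖F N y‖ ≤ C * (3 * Real.exp (c + 1) * Real.exp 4) * Real.exp (-|y|) := by
    filter_upwards [hΓ, hint, eventually_gt_atTop 0,
      hmesh.eventually_lt_const (by norm_num : (0 : ℝ) < 4),
      (hlim 1).eventually_lt_const (by nlinarith : c * 1 ^ 2 / 2 < c + 1),
      (hlim (-1)).eventually_lt_const (by nlinarith : c * (-1) ^ 2 / 2 < c + 1)]
      with N hN hi h0 hm h1 h2 y
    by_cases hy : saddleGrid N (Q N) 0 < y ∧ y ≤ saddleGrid N (Q N) N
    · obtain ⟨k, hk, hFk, hky⟩ := exists_gridStep_eq h0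
        (fun k => f (tiltedProb (Γ N) (saddleGrid N (Q N) k))) hy.1 hy.2
      simp only [hF, hFk, Real.norm_eq_abs]
      refine (hfC _ (tiltedProb_mem_Icc _ _)).trans ?_
      rw [mul_assoc C]
      refine mul_le_mul_of_nonneg_left ?_ hC
      refine (hN.tiltedProb_mul_le hC'.le h1.le h2.le (hi k hk)).trans ?_
      rw [mul_assoc _ (Real.exp 4)]
      refine mul_le_mul_of_nonneg_left ?_ (by positivity)
      rw [← Real.exp_add, Real.exp_le_exp]
      have := abs_sub_abs_le_abs_sub y (saddleGrid N (Q N) k)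
      rw [abs_sub_comm] at this
      linarith
    · have : F N y = 0 := gridStep_eq_zero h0 (by
        by_contra! h
        exact hy h)
      rw [this, norm_zero]
      positivity
  have hpt : ∀ᵐ y : ℝ, Tendsto (fun N => F N y) atTop
      (𝓝 (A.indicator (fun y => f (erfc (y / √(2 * c)) / 2)) y)) := by
    filter_upwards [hup] with y hy
    rcases hy with ⟨hyA, hy⟩ | ⟨hyA, hy⟩
    · rw [Set.indicator_of_mem hyA]
      have hev : ∀ᶠ N : ℕ in atTop, ∃ k : ℕ,
          F N y = f (tiltedProb (Γ N) (saddleGrid N (Q N) k)) ∧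
            |saddleGrid N (Q N) k - y| ≤ 4 / √N := by
        filter_upwards [hlow y, hy, eventually_gt_atTop 0] with N h1 h2 h0
        obtain ⟨k, -, h⟩ := exists_gridStep_eq h0
          (fun k => f (tiltedProb (Γ N) (saddleGrid N (Q N) k))) h1 h2
        exact ⟨k, h⟩
      obtain ⟨κ, hκ⟩ := hev.choice
      have hv : Tendsto (fun N => saddleGrid N (Q N) (κ N)) atTop (𝓝 y) := by
        rw [tendsto_iff_dist_tendsto_zero]
        refine squeeze_zero' (Eventually.of_forall fun _ => dist_nonneg) ?_ hmesh
        filter_upwards [hκ] with N h using h.2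
      refine ((hf.tendsto _).comp (tendsto_tiltedProb hc hΓ hlim hv)).congr' ?_
      filter_upwards [hκ] with N h using h.1.symm
    · rw [Set.indicator_of_notMem hyA]
      refine tendsto_const_nhds.congr' ?_
      filter_upwards [hy, eventually_gt_atTop 0] with N h h0
      exact (gridStep_eq_zero h0 (Or.inr h)).symm
  have hconv := tendsto_integral_filter_of_dominated_convergence _
    (Eventually.of_forall fun N => (measurable_gridStep _ _ _).aestronglyMeasurable)
    (hbound.mono fun N h => ae_of_all _ h) (integrable_exp_neg_abs.const_mul _) hpt
  rw [integral_indicator hA] at hconv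
  refine (hconv.const_mul (1 / 4)).congr' ?_
  filter_upwards [eventually_gt_atTop 0] with N h0
  change 1 / 4 * ∫ y, gridStep N (Q N) _ y = _
  rw [integral_gridStep h0]
  ring

/-- Monotonicity of the derivatives provides the bound on compact intervals under which pointwise
limits can be integrated. -/
theorem tendsto_of_hasDerivAt_monotone {Γ d : ℕ → ℝ → ℝ} {c : ℝ}
    (hd : ∀ᶠ N in atTop, ∀ s, HasDerivAt (Γ N) (d N s) s) (hmono : ∀ᶠ N in atTop, Monotone (d N))
    (h0 : ∀ N, Γ N 0 = 0) (hlim : ∀ s, Tendsto (fun N => d N s) atTop (𝓝 (c * s))) (s : ℝ) :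
    Tendsto (fun N => Γ N s) atTop (𝓝 (c * s ^ 2 / 2)) := by
  have hI : ∀ᶠ N in atTop, Γ N s = ∫ v in (0 : ℝ)..s, d N v := by
    filter_upwards [hd, hmono] with N h1 h2
    rw [intervalIntegral.integral_eq_sub_of_hasDerivAt (fun v _ => h1 v)
      (h2.intervalIntegrable), h0, sub_zero]
  have hL : ∫ v in (0 : ℝ)..s, c * v = c * s ^ 2 / 2 := by
    rw [intervalIntegral.integral_const_mul, integral_id]
    ring
  rw [← hL]
  refine Tendsto.congr' (hI.mono fun N h => h.symm) ?_
  set a := |s| with ha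
  refine intervalIntegral.tendsto_integral_filter_of_dominated_convergence
    (fun _ => |c * a| + |c * -a| + 1) ?_ ?_ (by simp) (ae_of_all _ fun v _ => hlim v)
  · filter_upwards [hmono] with N h using h.measurable.aestronglyMeasurable
  · filter_upwards [hmono, (hlim a).abs.eventually_lt_const (lt_add_one _),
      (hlim (-a)).abs.eventually_lt_const (lt_add_one _)] with N h h1 h2
    refine ae_of_all _ fun v hv => ?_
    have hv' : |v| ≤ a := by
      have := Set.abs_sub_left_of_mem_uIcc (Set.uIoc_subset_uIcc hv)
      simpa [ha] using this
    have h3 := h (abs_le.1 hv').2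
    have h4 := h (abs_le.1 hv').1
    rw [Real.norm_eq_abs, abs_le]
    have h5 := abs_le.1 h1.le
    have h6 := abs_le.1 h2.le
    constructor <;> linarith [abs_nonneg (c * a), abs_nonneg (c * -a), h5.1, h5.2, h6.1, h6.2]

/-! ### The Vandermonde determinant of the points and their conjugates -/

/-- The polynomial factor of the density of the planar symplectic ensemble. -/
noncomputable def symplecticFactor {N : ℕ} (z : Fin N → ℂ) : ℝ :=
  (∏ j, ∏ k ∈ Finset.Iio j, ‖z j - z k‖ ^ 2 * ‖z j - conj (z k)‖ ^ 2) *
    ∏ l, ‖z l - conj (z l)‖ ^ 2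

theorem ofReal_norm_sq_sub_conj (z w : ℂ) :
    ((‖z - conj w‖ ^ 2 : ℝ) : ℂ) = (z - conj w) * (conj z - w) := by
  have h := (Complex.mul_conj' (z - conj w)).symm
  simp only [map_sub, Complex.conj_conj] at h
  push_cast
  exact h

theorem prod_Ioi_eq_prod_ite {n : ℕ} (f : Fin n → Fin n → ℂ) :
    ∏ i, ∏ j ∈ Finset.Ioi i, f i j = ∏ i, ∏ j, if i < j then f i j else 1 := by
  refine Finset.prod_congr rfl fun i _ => ?_
  rw [← Finset.prod_filter]
  congr 1
  ext j
  simp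

/-- Up to a constant sign, the polynomial factor is `∏ (z_l - z̄_l)` times the Vandermonde
determinant of the `2 N` points `z_1, …, z_N, z̄_1, …, z̄_N`. -/
theorem exists_symplecticFactor_eq_det (N : ℕ) :
    ∃ ε : ℂ, ∀ z : Fin N → ℂ, (symplecticFactor z : ℂ)
      = ε * ((Matrix.vandermonde (Fin.append z fun l => conj (z l))).det
        * ∏ l, (z l - conj (z l))) := by
  refine ⟨∏ i : Fin N, ∏ j ∈ Finset.Ioi i, (-1 : ℂ), fun z => ?_⟩
  -- the factors mixing points and conjugates, paired as `(k, j)` with `(j, k)`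
  have hcross : ∏ i : Fin N, ∏ j : Fin N, (conj (z j) - z i)
      = (∏ i, ∏ j ∈ Finset.Ioi i, (conj (z j) - z i) * (conj (z i) - z j))
        * ∏ i, (conj (z i) - z i) := by
    have h1 : ∀ f : Fin N → Fin N → ℂ, ∏ i, ∏ j, f i j
        = (∏ i, ∏ j ∈ Finset.Ioi i, f i j * f j i) * ∏ i, f i i := by
      intro f
      have hsplit : ∀ i j, f i j = (if i < j then f i j else 1) * (if j < i then f i j else 1)
          * (if i = j then f i j else 1) := by
        intro i j
        rcases lt_trichotomy i j with h | h | h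
        · simp [h, h.not_gt, h.ne]
        · simp [h]
        · simp [h, h.not_gt, h.ne']
      have h2 : ∏ i, ∏ j, (if j < i then f i j else 1)
          = ∏ i, ∏ j, (if i < j then f j i else 1) := Finset.prod_comm
      calc ∏ i, ∏ j, f i j
          = ∏ i, ∏ j, (if i < j then f i j else 1) * (if j < i then f i j else 1)
            * (if i = j then f i j else 1) :=
            Finset.prod_congr rfl fun i _ => Finset.prod_congr rfl fun j _ => hsplit i j
        _ = _ := by
            simp only [Finset.prod_mul_distrib, h2, prod_Ioi_eq_prod_ite]
            simp
    exact h1 fun i j => conj (z j) - z i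
  have hdet : (Matrix.vandermonde (Fin.append z fun l => conj (z l))).det
      = (∏ i, ∏ j ∈ Finset.Ioi i, (z j - z i))
        * (∏ i, ∏ j ∈ Finset.Ioi i, (conj (z j) - conj (z i)))
        * ∏ i : Fin N, ∏ j : Fin N, (conj (z j) - z i) := by
    rw [Matrix.det_vandermonde]
    simp only [prod_Ioi_eq_prod_ite, Fin.prod_univ_add, Fin.append_left, Fin.append_right,
      Finset.prod_mul_distrib]
    have h1 : ∀ i j : Fin N, Fin.castAdd N i < Fin.castAdd N j ↔ i < j := fun i j => Iff.rfl
    have h2 : ∀ i j : Fin N, Fin.natAdd N i < Fin.natAdd N j ↔ i < j := fun i j => by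
      change N + (i : ℕ) < N + j ↔ (i : ℕ) < j
      omega
    have h3 : ∀ i j : Fin N, Fin.castAdd N i < Fin.natAdd N j := fun i j => by
      change (i : ℕ) < N + j
      omega
    have h4 : ∀ i j : Fin N, ¬ Fin.natAdd N i < Fin.castAdd N j := fun i j => (h3 j i).not_gt
    simp only [h1, h2, h3, h4, if_true, if_false, Finset.prod_const_one]
    ring
  have hswap : ∏ j, ∏ k ∈ Finset.Iio j, ((‖z j - z k‖ ^ 2 * ‖z j - conj (z k)‖ ^ 2 : ℝ) : ℂ)
      = ∏ i, ∏ j ∈ Finset.Ioi i, ((‖z j - z i‖ ^ 2 * ‖z j - conj (z i)‖ ^ 2 : ℝ) : ℂ) := by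
    refine Finset.prod_comm' fun i j => ?_
    simp
  have hn : ∀ i j, ((‖z j - z i‖ ^ 2 : ℝ) : ℂ) = (z j - z i) * (conj (z j) - conj (z i)) := by
    intro i j
    have := ofReal_norm_sq_sub_conj (z j) (conj (z i))
    rwa [Complex.conj_conj] at this
  rw [symplecticFactor, Complex.ofReal_mul, Complex.ofReal_prod, Complex.ofReal_prod]
  simp_rw [Complex.ofReal_prod]
  rw [hswap, hdet, hcross]
  simp_rw [Complex.ofReal_mul, hn, ofReal_norm_sq_sub_conj]
  simp only [Finset.prod_mul_distrib]
  have e1 : ∏ i, ∏ j ∈ Finset.Ioi i, (conj (z i) - z j)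
      = (∏ i : Fin N, ∏ j ∈ Finset.Ioi i, (-1 : ℂ))
        * ∏ i, ∏ j ∈ Finset.Ioi i, (z j - conj (z i)) := by
    simp only [← Finset.prod_mul_distrib]
    simp
  have e2 : ∏ i, (conj (z i) - z i) = (∏ _i : Fin N, (-1 : ℂ)) * ∏ i, (z i - conj (z i)) := by
    rw [← Finset.prod_mul_distrib]
    simp
  have s1 : (∏ i : Fin N, ∏ j ∈ Finset.Ioi i, (-1 : ℂ))
      * (∏ i : Fin N, ∏ j ∈ Finset.Ioi i, (-1 : ℂ)) = 1 := by
    simp only [← Finset.prod_mul_distrib]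
    simp
  rw [e1, e2]
  set a := (∏ i : Fin N, ∏ j ∈ Finset.Ioi i, (-1 : ℂ))
  set b := ∏ _i : Fin N, (-1 : ℂ)
  set p1 := ∏ i, ∏ j ∈ Finset.Ioi i, (z j - z i)
  set p2 := ∏ i, ∏ j ∈ Finset.Ioi i, (conj (z j) - conj (z i))
  set p3 := ∏ i, ∏ j ∈ Finset.Ioi i, (conj (z j) - z i)
  set p4 := ∏ i, ∏ j ∈ Finset.Ioi i, (z j - conj (z i))
  set p5 := ∏ i, (z i - conj (z i))
  linear_combination (-(p1 * p2 * p3 * p4 * p5 * b * p5)) * s1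

/-! ### Mixed moments of a radial weight -/

theorem integral_pow_mul_conj_pow_of_ne (φ : ℝ → ℝ) {m n : ℕ} (h : m ≠ n) :
    ∫ z : ℂ, z ^ m * conj z ^ n * φ ‖z‖ = 0 := by
  set F : ℂ → ℂ := fun z => z ^ m * conj z ^ n * φ ‖z‖ with hF
  have hmn : ((m : ℝ) - n) ≠ 0 := sub_ne_zero.2 (by exact_mod_cast h)
  -- the rotation by `π / (m - n)` changes the sign of the integrand
  set θ : ℝ := Real.pi / (m - n) with hθ
  set c : Circle := Circle.exp θ
  have h1 : ∫ z, F (rotation c z) = ∫ z, F z :=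
    (rotation c).measurePreserving.integral_comp
      (rotation c).toHomeomorph.measurableEmbedding F
  have hc : (c : ℂ) ^ m * conj (c : ℂ) ^ n = -1 := by
    rw [Circle.coe_exp, ← Complex.exp_conj, ← Complex.exp_nat_mul, ← Complex.exp_nat_mul,
      ← Complex.exp_add, ← Complex.exp_pi_mul_I]
    congr 1
    simp only [map_mul, Complex.conj_ofReal, Complex.conj_I]
    have : ((m : ℝ) - n) * θ = Real.pi := by rw [hθ]; field_simp
    have h3 : ((m : ℂ) - n) * θ = Real.pi := by exact_mod_cast this
    linear_combination Complex.I * h3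
  have h2 : ∀ z, F (rotation c z) = -F z := by
    intro z
    simp only [hF, LinearIsometryEquiv.norm_map]
    rw [rotation_apply, map_mul, mul_pow, mul_pow]
    linear_combination (z ^ m * conj z ^ n * φ ‖z‖) * hc
  simp_rw [h2, integral_neg] at h1
  exact self_eq_neg.1 h1.symm

theorem integral_pow_mul_conj_pow_self (φ : ℝ → ℝ) (n : ℕ) :
    ∫ z : ℂ, z ^ n * conj z ^ n * φ ‖z‖ = ((∫ z : ℂ, ‖z‖ ^ (2 * n) * φ ‖z‖ : ℝ) : ℂ) := by
  rw [← integral_complex_ofReal]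
  congr 1
  ext z
  rw [← mul_pow, Complex.mul_conj']
  push_cast
  ring

theorem integrable_pow_mul_conj_pow {φ : ℝ → ℝ}
    (hφ : ∀ n : ℕ, Integrable fun z : ℂ => ‖z‖ ^ n * φ ‖z‖) (m n : ℕ) :
    Integrable fun z : ℂ => z ^ m * conj z ^ n * φ ‖z‖ := by
  have h0 : AEStronglyMeasurable fun z : ℂ => φ ‖z‖ := by
    simpa using (hφ 0).aestronglyMeasurable
  refine (hφ (m + n)).norm.mono' ?_ (ae_of_all _ fun z => ?_)
  · exact (by fun_prop : Continuous fun z : ℂ => z ^ m * conj z ^ n).aestronglyMeasurable.mul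
      (Complex.continuous_ofReal.comp_aestronglyMeasurable h0)
  · simp [pow_add]

/-- The sign of the skew moment of the monomials of degree `j` and `k`, which vanishes unless the
degrees are consecutive. -/
def skewSign (j k : ℕ) : ℂ := if j + 1 = k then 1 else if k + 1 = j then -1 else 0

theorem integral_skew_moment {φ : ℝ → ℝ}
    (hφ : ∀ n : ℕ, Integrable fun z : ℂ => ‖z‖ ^ n * φ ‖z‖) (j k : ℕ) :
    ∫ z : ℂ, z ^ j * conj z ^ k * ((z - conj z) * φ ‖z‖)
      = skewSign j k * ((∫ z : ℂ, ‖z‖ ^ (2 * max j k) * φ ‖z‖ : ℝ) : ℂ) := by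
  have h1 : ∀ z : ℂ, z ^ j * conj z ^ k * ((z - conj z) * φ ‖z‖)
      = z ^ (j + 1) * conj z ^ k * φ ‖z‖ - z ^ j * conj z ^ (k + 1) * φ ‖z‖ := fun z => by ring
  simp_rw [h1]
  rw [integral_sub (integrable_pow_mul_conj_pow hφ _ _) (integrable_pow_mul_conj_pow hφ _ _),
    skewSign]
  split_ifs with h2 h3
  · subst h2
    rw [integral_pow_mul_conj_pow_self, integral_pow_mul_conj_pow_of_ne φ (by omega)]
    simp
  · subst h3
    rw [integral_pow_mul_conj_pow_self, integral_pow_mul_conj_pow_of_ne φ (by omega)]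
    simp
  · rw [integral_pow_mul_conj_pow_of_ne φ h2, integral_pow_mul_conj_pow_of_ne φ (by omega)]
    simp

/-! ### Perfect matchings by consecutive integers -/

/-- The only perfect matching of `0, 1, …, 2 N - 1` by pairs of consecutive integers is
`{0, 1}, {2, 3}, …`. -/
theorem prod_max_consecutive {N : ℕ} {A B : Fin N → ℕ} (hA : Function.Injective A)
    (hB : Function.Injective B) (hAB : ∀ l l', A l ≠ B l') (hA2 : ∀ l, A l < N + N)
    (hB2 : ∀ l, B l < N + N) (hsurj : ∀ v < N + N, ∃ l, A l = v ∨ B l = v)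
    (hadj : ∀ l, A l + 1 = B l ∨ B l + 1 = A l) (m : ℕ → ℂ) :
    ∏ l, m (max (A l) (B l)) = ∏ l : Fin N, m (2 * l + 1) := by
  -- if the smaller element `v` of a pair were odd, the partner of `v - 1` would have to be `v - 2`,
  -- and `v - 2` would be the odd smaller element of another pair
  have heven : ∀ v l, min (A l) (B l) = v → Even v := by
    intro v
    induction v using Nat.strong_induction_on with
    | _ v ih =>
      intro l hl
      by_contra hodd
      rw [Nat.not_even_iff_odd] at hodd
      have hv : 1 ≤ v := hodd.pos
      have hAl := hA2 l
      obtain ⟨l', hl'⟩ := hsurj (v - 1) (by omega)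
      have hne : l' ≠ l := by
        rintro rfl
        omega
      have h1 : A l' ≠ A l := fun h => hne (hA h)
      have h2 : B l' ≠ B l := fun h => hne (hB h)
      have h3 := hAB l l'
      have h4 := hAB l' l
      have h5 := hadj l
      have h6 := hadj l'
      have h7 : min (A l') (B l') + 2 = v := by omega
      have h8 := ih (min (A l') (B l')) (by omega) l' rfl
      rw [← h7] at hodd
      exact (Nat.not_even_iff_odd.2 hodd) (by simpa [Nat.even_add] using h8)
  have hlt : ∀ l, min (A l) (B l) / 2 < N := fun l => by
    have := hA2 l
    have := hB2 l
    omega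
  have hmax : ∀ l, max (A l) (B l) = 2 * (min (A l) (B l) / 2) + 1 := by
    intro l
    obtain ⟨t, ht⟩ := heven _ l rfl
    have := hadj l
    omega
  have hbij : Function.Bijective fun l => (⟨min (A l) (B l) / 2, hlt l⟩ : Fin N) := by
    rw [← Finite.injective_iff_bijective]
    intro l l' h
    have h1 : min (A l) (B l) / 2 = min (A l') (B l') / 2 := by simpa using h
    have h2 := hmax l
    have h3 := hmax l'
    have h4 := hadj l
    have h5 := hadj l'
    have h6 := hAB l l'
    have h7 := hAB l' l
    by_contra hne
    have h8 : A l ≠ A l' := fun h => hne (hA h)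
    have h9 : B l ≠ B l' := fun h => hne (hB h)
    omega
  simp_rw [hmax]
  exact hbij.prod_comp fun i : Fin N => m (2 * i + 1)

/-! ### Factorization of radial statistics -/

/-- Expansion of the Vandermonde determinant over permutations of the `2 N` degrees. -/
theorem exists_symplecticFactor_expansion (N : ℕ) :
    ∃ ε : ℂ, ∀ (φ : ℝ → ℝ) (z : Fin N → ℂ),
      ((symplecticFactor z * ∏ l, φ ‖z l‖ : ℝ) : ℂ)
        = ε * ∑ σ : Equiv.Perm (Fin (N + N)), (Equiv.Perm.sign σ : ℂ) *
          ∏ l, (z l ^ (σ (Fin.castAdd N l) : ℕ) * conj (z l) ^ (σ (Fin.natAdd N l) : ℕ)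
            * ((z l - conj (z l)) * φ ‖z l‖)) := by
  obtain ⟨ε, hε⟩ := exists_symplecticFactor_eq_det N
  refine ⟨ε, fun φ z => ?_⟩
  rw [Complex.ofReal_mul, hε, ← Matrix.det_transpose, Matrix.det_apply', Complex.ofReal_prod,
    mul_assoc, mul_assoc, ← Finset.prod_mul_distrib, Finset.sum_mul]
  congr 1
  refine Finset.sum_congr rfl fun σ _ => ?_
  rw [mul_assoc, Fin.prod_univ_add]
  simp only [Matrix.transpose_apply, Matrix.vandermonde_apply, Fin.append_left, Fin.append_right,
    Finset.prod_mul_distrib]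

theorem integrable_permutation_term {N : ℕ} {φ : ℝ → ℝ}
    (hφ : ∀ n : ℕ, Integrable fun z : ℂ => ‖z‖ ^ n * φ ‖z‖) (σ : Equiv.Perm (Fin (N + N))) :
    Integrable fun z : Fin N → ℂ => (Equiv.Perm.sign σ : ℂ) *
      ∏ l, (z l ^ (σ (Fin.castAdd N l) : ℕ) * conj (z l) ^ (σ (Fin.natAdd N l) : ℕ)
        * ((z l - conj (z l)) * φ ‖z l‖)) := by
  refine Integrable.const_mul (Integrable.fintype_prod (f := fun (l : Fin N) (w : ℂ) =>
    w ^ (σ (Fin.castAdd N l) : ℕ) * conj w ^ (σ (Fin.natAdd N l) : ℕ)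
      * ((w - conj w) * φ ‖w‖)) fun l => ?_) _
  refine ((integrable_pow_mul_conj_pow hφ (σ (Fin.castAdd N l) + 1) (σ (Fin.natAdd N l))).sub
    (integrable_pow_mul_conj_pow hφ (σ (Fin.castAdd N l)) (σ (Fin.natAdd N l) + 1))).congr
    (ae_of_all _ fun z => ?_)
  simp only [Pi.sub_apply]
  ring

/-- The integral of a product of radial functions against the polynomial factor is, up to a
constant that depends only on the number of points, a product of one-dimensional moments: only the
permutations that pair consecutive degrees survive the angular integration. -/
theorem exists_integral_symplecticFactor (N : ℕ) :
    ∃ K : ℂ, ∀ φ : ℝ → ℝ, (∀ n : ℕ, Integrable fun z : ℂ => ‖z‖ ^ n * φ ‖z‖) →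
      ((∫ z : Fin N → ℂ, symplecticFactor z * ∏ l, φ ‖z l‖ : ℝ) : ℂ)
        = K * ∏ i : Fin N, ((∫ z : ℂ, ‖z‖ ^ (2 * (2 * (i : ℕ) + 1)) * φ ‖z‖ : ℝ) : ℂ) := by
  obtain ⟨ε, hε⟩ := exists_symplecticFactor_expansion N
  refine ⟨ε * ∑ σ : Equiv.Perm (Fin (N + N)), (Equiv.Perm.sign σ : ℂ) *
    ∏ l, skewSign (σ (Fin.castAdd N l)) (σ (Fin.natAdd N l)), fun φ hφ => ?_⟩
  rw [← integral_complex_ofReal]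
  simp_rw [hε]
  rw [integral_const_mul, integral_finsetSum _ fun σ _ => integrable_permutation_term hφ σ,
    mul_assoc, Finset.sum_mul]
  congr 1
  refine Finset.sum_congr rfl fun σ _ => ?_
  rw [integral_const_mul, mul_assoc]
  congr 1
  rw [integral_fintype_prod_volume_eq_prod fun (l : Fin N) (z : ℂ) =>
    z ^ (σ (Fin.castAdd N l) : ℕ) * conj z ^ (σ (Fin.natAdd N l) : ℕ) * ((z - conj z) * φ ‖z‖)]
  simp_rw [integral_skew_moment hφ]
  rw [Finset.prod_mul_distrib]
  by_cases h : ∀ l, skewSign (σ (Fin.castAdd N l)) (σ (Fin.natAdd N l)) ≠ 0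
  · congr 1
    refine prod_max_consecutive (A := fun l => (σ (Fin.castAdd N l) : ℕ))
      (B := fun l => (σ (Fin.natAdd N l) : ℕ)) ?_ ?_ ?_ (fun l => (σ _).2) (fun l => (σ _).2) ?_ ?_
      fun n => ((∫ z : ℂ, ‖z‖ ^ (2 * n) * φ ‖z‖ : ℝ) : ℂ)
    · intro l l' hl
      simpa using σ.injective (Fin.ext hl)
    · intro l l' hl
      simpa using σ.injective (Fin.ext hl)
    · intro l l' hl
      have := congrArg Fin.val (σ.injective (Fin.ext hl))
      simp only [Fin.val_castAdd, Fin.val_natAdd] at this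
      omega
    · intro v hv
      obtain ⟨x, hx⟩ := σ.surjective ⟨v, hv⟩
      have hx' := congrArg Fin.val hx
      induction x using Fin.addCases with
      | left l => exact ⟨l, Or.inl hx'⟩
      | right l => exact ⟨l, Or.inr hx'⟩
    · intro l
      have := h l
      rw [skewSign] at this
      split_ifs at this with h1 h2
      · exact Or.inl h1
      · exact Or.inr h2
      · exact absurd rfl this
  · push Not at h
    obtain ⟨l, hl⟩ := h
    rw [Finset.prod_eq_zero (Finset.mem_univ l) hl, zero_mul, zero_mul]

theorem integrable_symplecticFactor {N : ℕ} {φ : ℝ → ℝ}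
    (hφ : ∀ n : ℕ, Integrable fun z : ℂ => ‖z‖ ^ n * φ ‖z‖) :
    Integrable fun z : Fin N → ℂ => symplecticFactor z * ∏ l, φ ‖z l‖ := by
  obtain ⟨ε, hε⟩ := exists_symplecticFactor_expansion N
  have : Integrable fun z : Fin N → ℂ => ((symplecticFactor z * ∏ l, φ ‖z l‖ : ℝ) : ℂ) := by
    simp_rw [hε]
    exact (integrable_finsetSum _ fun σ _ => integrable_permutation_term hφ σ).const_mul _
  exact this.re

theorem symplecticWeight_radialPotential (N : ℕ) (g : ℝ → ℝ) (z : Fin N → ℂ) :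
    symplecticWeight N (radialPotential g) z
      = symplecticFactor z * ∏ l, Real.exp (-(N * g ‖z l‖)) := by
  rw [symplecticWeight, symplecticFactor, Finset.prod_mul_distrib, mul_assoc]
  rfl

theorem symplecticFactor_nonneg {N : ℕ} (z : Fin N → ℂ) : 0 ≤ symplecticFactor z := by
  unfold symplecticFactor
  positivity

/-- The partition function does not vanish, so that the constant in
`exists_integral_symplecticFactor` is not zero and cancels from expectations. -/
theorem integral_symplecticFactor_pos {N : ℕ} {φ : ℝ → ℝ}
    (hφ : ∀ n : ℕ, Integrable fun z : ℂ => ‖z‖ ^ n * φ ‖z‖) (hpos : ∀ r, 0 < φ r) :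
    0 < ∫ z : Fin N → ℂ, symplecticFactor z * ∏ l, φ ‖z l‖ := by
  rw [integral_pos_iff_support_of_nonneg (fun z => mul_nonneg (symplecticFactor_nonneg z)
    (Finset.prod_nonneg fun l _ => (hpos _).le)) (integrable_symplecticFactor hφ)]
  have hsupp : Function.support (fun z : Fin N → ℂ => symplecticFactor z * ∏ l, φ ‖z l‖)
      = {z | symplecticFactor z ≠ 0} := by
    ext z
    have : ∏ l, φ ‖z l‖ ≠ 0 := Finset.prod_ne_zero_iff.2 fun l _ => (hpos _).ne'
    simp [this]
  have hcont : Continuous fun z : Fin N → ℂ => symplecticFactor z := by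
    unfold symplecticFactor
    fun_prop
  rw [hsupp]
  refine (isOpen_ne_fun hcont continuous_const).measure_pos volume
    ⟨fun l => ((l : ℕ) + 1 : ℂ) * Complex.I, ?_⟩
  -- distinct points on the positive imaginary axis
  have hne : ∀ x y : ℕ, ((x : ℂ) + 1) * Complex.I - conj (((y : ℂ) + 1) * Complex.I) ≠ 0 := by
    intro x y h
    have h1 := congrArg Complex.im h
    simp at h1
    have : (0 : ℝ) ≤ x := Nat.cast_nonneg x
    have : (0 : ℝ) ≤ y := Nat.cast_nonneg y
    linarith
  change symplecticFactor _ ≠ 0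
  refine mul_ne_zero (Finset.prod_ne_zero_iff.2 fun j _ => Finset.prod_ne_zero_iff.2 fun k hk =>
    mul_ne_zero (pow_ne_zero _ (norm_ne_zero_iff.2 ?_)) (pow_ne_zero _ (norm_ne_zero_iff.2 ?_)))
    (Finset.prod_ne_zero_iff.2 fun l _ => pow_ne_zero _ (norm_ne_zero_iff.2 (hne _ _)))
  · intro h
    have h1 := congrArg Complex.im h
    simp only [Complex.sub_im, Complex.mul_im, Complex.I_im, Complex.I_re, Complex.add_re,
      Complex.natCast_re, Complex.one_re] at h1
    have h2 : (j : ℕ) = (k : ℕ) := by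
      have : ((j : ℕ) : ℝ) = (k : ℕ) := by simpa [sub_eq_zero] using h1
      exact_mod_cast this
    have := Finset.mem_Iio.1 hk
    exact this.ne' (Fin.ext h2)
  · exact hne _ _

/-- The count of a disc is distributed as a sum of independent Bernoulli variables. -/
theorem mgf_discCount {N : ℕ} {g : ℝ → ℝ}
    (hg : ∀ n : ℕ, Integrable fun z : ℂ => ‖z‖ ^ n * Real.exp (-(N * g ‖z‖))) (a u : ℝ) :
    ProbabilityTheory.mgf (discCount a) (symplecticEnsemble N (radialPotential g)) u
      = ∏ i : Fin N, (∫ z : ℂ, ‖z‖ ^ (2 * (2 * (i : ℕ) + 1)) *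
            ((if ‖z‖ ≤ a then Real.exp u else 1) * Real.exp (-(N * g ‖z‖)))) /
          ∫ z : ℂ, ‖z‖ ^ (2 * (2 * (i : ℕ) + 1)) * Real.exp (-(N * g ‖z‖)) := by
  set φ : ℝ → ℝ := fun r => Real.exp (-(N * g r)) with hφ
  set ψ : ℝ → ℝ := fun r => (if r ≤ a then Real.exp u else 1) * φ r with hψ
  have hψi : ∀ n : ℕ, Integrable fun z : ℂ => ‖z‖ ^ n * ψ ‖z‖ := by
    intro n
    have hm : Measurable fun z : ℂ => if ‖z‖ ≤ a then Real.exp u else 1 :=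
      Measurable.ite (measurableSet_le measurable_norm measurable_const) measurable_const
        measurable_const
    refine ((hg n).bdd_mul (c := Real.exp u + 1) hm.aestronglyMeasurable
      (ae_of_all _ fun z => ?_)).congr (ae_of_all _ fun z => ?_)
    · have := Real.exp_pos u
      split_ifs
      · rw [Real.norm_of_nonneg this.le]; linarith
      · rw [norm_one]; linarith
    · simp only [hψ, hφ]
      ring
  obtain ⟨K, hK⟩ := exists_integral_symplecticFactor N
  have hw : ∀ z : Fin N → ℂ, symplecticWeight N (radialPotential g) z
      = symplecticFactor z * ∏ l, φ ‖z l‖ := symplecticWeight_radialPotential N g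
  have hZ := integral_symplecticFactor_pos (N := N) (φ := φ) hg fun r => Real.exp_pos _
  have h1 := hK φ hg
  have h2 := hK ψ hψi
  set Z : ℝ := ∫ z : Fin N → ℂ, symplecticFactor z * ∏ l, φ ‖z l‖ with hZdef
  have hmgf : ProbabilityTheory.mgf (discCount a) (symplecticEnsemble N (radialPotential g)) u
      = (∫ z : Fin N → ℂ, symplecticFactor z * ∏ l, ψ ‖z l‖) / Z := by
    rw [ProbabilityTheory.mgf, symplecticEnsemble]
    simp_rw [hw]
    rw [integral_withDensity_eq_integral_toReal_smul₀, ← integral_div]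
    · refine integral_congr_ae (ae_of_all _ fun z => ?_)
      have h0 : 0 ≤ symplecticFactor z * ∏ l, φ ‖z l‖ :=
        mul_nonneg (symplecticFactor_nonneg z) (Finset.prod_nonneg fun l _ => (Real.exp_pos _).le)
      simp only
      rw [ENNReal.toReal_ofReal (div_nonneg h0 hZ.le), smul_eq_mul]
      have hexp : Real.exp (u * discCount a z) = ∏ l, if ‖z l‖ ≤ a then Real.exp u else 1 := by
        rw [Finset.prod_ite, Finset.prod_const, Finset.prod_const_one, mul_one, discCount,
          mul_comm, Real.exp_nat_mul]
      rw [hexp]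
      simp only [hψ, Finset.prod_mul_distrib]
      ring
    · exact ((integrable_symplecticFactor (φ := φ) hg).div_const _).aemeasurable.ennreal_ofReal
    · exact ae_of_all _ fun _ => ENNReal.ofReal_lt_top
  have hcast : ((ProbabilityTheory.mgf (discCount a)
      (symplecticEnsemble N (radialPotential g)) u : ℝ) : ℂ)
      = ((∏ i : Fin N, (∫ z : ℂ, ‖z‖ ^ (2 * (2 * (i : ℕ) + 1)) * ψ ‖z‖) /
          ∫ z : ℂ, ‖z‖ ^ (2 * (2 * (i : ℕ) + 1)) * φ ‖z‖ : ℝ) : ℂ) := by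
    have hZ0 : (Z : ℂ) ≠ 0 := by exact_mod_cast hZ.ne'
    rw [h1] at hZ0
    rw [hmgf, Complex.ofReal_div, h1, h2, mul_div_mul_left _ _ (left_ne_zero_of_mul hZ0),
      ← Finset.prod_div_distrib]
    push_cast
    rfl
  exact_mod_cast hcast

/-! ### Radial integrals in logarithmic coordinates -/

theorem exists_integral_norm_eq :
    ∃ C : ℝ, 0 < C ∧ ∀ F : ℝ → ℝ,
      ∫ z : ℂ, F ‖z‖ = C * ∫ t, Real.exp (2 * t) * F (Real.exp t) := by
  refine ⟨2 * (volume : Measure ℂ).real (Metric.ball 0 1), ?_, fun F => ?_⟩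
  · have : 0 < (volume : Measure ℂ).real (Metric.ball 0 1) :=
      ENNReal.toReal_pos (Metric.measure_ball_pos volume 0 one_pos).ne' measure_ball_lt_top.ne
    positivity
  · rw [integral_fun_norm_addHaar, Complex.finrank_real_complex, ← Real.range_exp, ← Set.image_univ,
      integral_image_eq_integral_abs_deriv_smul MeasurableSet.univ
        (fun t _ => (Real.hasDerivAt_exp t).hasDerivWithinAt) Real.exp_injective.injOn]
    simp only [Measure.restrict_univ, smul_eq_mul, nsmul_eq_mul, Nat.cast_ofNat, Real.abs_exp]
    rw [mul_assoc]
    congr 3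
    ext t
    rw [two_mul, Real.exp_add]
    ring

theorem integrable_norm_iff (F : ℝ → ℝ) :
    (Integrable fun z : ℂ => F ‖z‖) ↔ Integrable fun t => Real.exp (2 * t) * F (Real.exp t) := by
  rw [integrable_fun_norm_addHaar, Complex.finrank_real_complex, ← Real.range_exp, ← Set.image_univ,
    integrableOn_image_iff_integrableOn_abs_deriv_smul MeasurableSet.univ
      (fun t _ => (Real.hasDerivAt_exp t).hasDerivWithinAt) Real.exp_injective.injOn,
    integrableOn_univ]
  refine integrable_congr (ae_of_all _ fun t => ?_)
  simp only [smul_eq_mul, Real.abs_exp]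
  rw [two_mul, Real.exp_add]
  ring

/-- The moments of `exp (-N g)` are finite: `g` grows faster than the logarithm at infinity, and is
`o(log)` at the origin. -/
theorem integrable_exp_mul_sub {g : ℝ → ℝ} (hg : DifferentiableOn ℝ g (Set.Ioi 0))
    (hgrowth : Tendsto (fun r => g r / Real.log r) atTop atTop)
    (hzero : Tendsto (fun r => r * deriv g r) (𝓝[>] 0) (𝓝 0)) {N : ℕ} (hN : 1 ≤ N) {m : ℝ}
    (hm : 0 < m) : Integrable fun t => Real.exp (m * t - N * g (Real.exp t)) := by
  have hN' : (1 : ℝ) ≤ N := by exact_mod_cast hN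
  have hd : ∀ t, HasDerivAt (fun t => g (Real.exp t)) (deriv g (Real.exp t) * Real.exp t) t :=
    fun t => (hg.differentiableAt (Ioi_mem_nhds (Real.exp_pos t))).hasDerivAt.comp t
      (Real.hasDerivAt_exp t)
  have hc : Continuous fun t => g (Real.exp t) :=
    continuous_iff_continuousAt.2 fun t => (hd t).continuousAt
  refine LocallyIntegrable.integrable_of_isBigO_atBot_atTop
    (g := fun t => Real.exp (m / 2 * t)) (g' := fun t => Real.exp (-t))
    (Real.continuous_exp.comp ((continuous_const.mul continuous_id).sub
      (continuous_const.mul hc))).locallyIntegrable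
    ?_ ⟨Set.Iic 0, Iic_mem_atBot 0, integrableOn_exp_mul_Iic (by positivity) 0⟩
    ?_ ⟨Set.Ioi 0, Ioi_mem_atTop 0, integrableOn_exp_neg_Ioi 0⟩
  -- near the origin, half of the exponent absorbs `g`
  · have h1 : ∀ᶠ t in atBot, Real.exp t * deriv g (Real.exp t) < m / (2 * N) :=
      ((hzero.comp Real.tendsto_exp_atBot_nhdsGT)).eventually_lt_const (by positivity)
    obtain ⟨T, hT⟩ := eventually_atBot.1 h1
    have hmono : MonotoneOn (fun t => m / 2 * t - N * g (Real.exp t)) (Set.Iic T) := by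
      have hd' : ∀ t, HasDerivAt (fun t => m / 2 * t - N * g (Real.exp t))
          (m / 2 - N * (deriv g (Real.exp t) * Real.exp t)) t := fun t =>
        (((hasDerivAt_id t).const_mul (m / 2)).sub ((hd t).const_mul (N : ℝ))).congr_deriv
          (by simp)
      refine monotoneOn_of_deriv_nonneg (convex_Iic T)
        (fun t _ => (hd' t).continuousAt.continuousWithinAt)
        (fun t _ => (hd' t).differentiableAt.differentiableWithinAt) fun t ht => ?_
      rw [(hd' t).deriv]
      have h2 := hT t (interior_subset ht : t ∈ Set.Iic T)
      rw [lt_div_iff₀ (by positivity)] at h2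
      linarith
    refine Asymptotics.IsBigO.of_bound (Real.exp (m / 2 * T - N * g (Real.exp T))) ?_
    filter_upwards [Iic_mem_atBot T] with t ht
    rw [Real.norm_of_nonneg (Real.exp_pos _).le, Real.norm_of_nonneg (Real.exp_pos _).le,
      ← Real.exp_add, Real.exp_le_exp]
    have := hmono ht (Set.mem_Iic.2 le_rfl) ht
    simp only at this
    linarith
  · refine Asymptotics.IsBigO.of_bound 1 ?_
    filter_upwards [(hgrowth.comp Real.tendsto_exp_atTop).eventually_ge_atTop (m + 1),
      eventually_gt_atTop 0] with t h1 h2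
    rw [Real.norm_of_nonneg (Real.exp_pos _).le, Real.norm_of_nonneg (Real.exp_pos _).le, one_mul,
      Real.exp_le_exp]
    simp only [Function.comp_apply, Real.log_exp] at h1
    rw [le_div_iff₀ h2] at h1
    have h3 : 0 ≤ g (Real.exp t) := le_trans (by positivity) h1
    nlinarith

theorem integrable_pow_mul_exp_neg {g : ℝ → ℝ} (hg : DifferentiableOn ℝ g (Set.Ioi 0))
    (hgrowth : Tendsto (fun r => g r / Real.log r) atTop atTop)
    (hzero : Tendsto (fun r => r * deriv g r) (𝓝[>] 0) (𝓝 0)) {N : ℕ} (hN : 1 ≤ N) (n : ℕ) :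
    Integrable fun z : ℂ => ‖z‖ ^ n * Real.exp (-(N * g ‖z‖)) := by
  rw [integrable_norm_iff fun r => r ^ n * Real.exp (-(N * g r))]
  refine (integrable_exp_mul_sub hg hgrowth hzero hN (m := n + 2) (by positivity)).congr
    (ae_of_all _ fun t => ?_)
  simp only
  rw [← Real.exp_nat_mul, ← Real.exp_add, ← Real.exp_add]
  congr 1
  ring

/-! ### The rescaled potential near a circle -/

/-- The potential `N g` in the logarithmic coordinate `r = a exp (s / √N)` around `r = a`, with
its tangent at `s = 0` subtracted. -/
noncomputable def saddleWell (N : ℕ) (g : ℝ → ℝ) (a s : ℝ) : ℝ :=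
  N * (g (a * Real.exp (s / √N)) - g a) - √N * (a * deriv g a) * s

theorem saddleWell_zero (N : ℕ) (g : ℝ → ℝ) (a : ℝ) : saddleWell N g a 0 = 0 := by
  simp [saddleWell]

theorem hasDerivAt_saddleWell {g : ℝ → ℝ} (hg : DifferentiableOn ℝ g (Set.Ioi 0)) {N : ℕ}
    (hN : 1 ≤ N) {a : ℝ} (ha : 0 < a) (s : ℝ) :
    HasDerivAt (saddleWell N g a) (√N * (a * Real.exp (s / √N) * deriv g (a * Real.exp (s / √N))
      - a * deriv g a)) s := by
  have hN0 : (0 : ℝ) < N := by exact_mod_cast hN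
  have hs : √(N : ℝ) ≠ 0 := by positivity
  have hsq : √(N : ℝ) * √N = N := Real.mul_self_sqrt hN0.le
  have h1 : HasDerivAt (fun s => a * Real.exp (s / √N)) (a * (Real.exp (s / √N) * (1 / √N))) s :=
    (((hasDerivAt_id s).div_const _).exp).const_mul a
  have h2 := (hg.differentiableAt (Ioi_mem_nhds (by positivity :
    0 < a * Real.exp (s / √N)))).hasDerivAt.comp s h1
  have h3 := ((h2.sub_const (g a)).const_mul (N : ℝ)).sub
    ((hasDerivAt_id s).const_mul (√N * (a * deriv g a)))
  refine h3.congr_deriv ?_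
  have hdiv : (N : ℝ) * (1 / √N) = √N := by
    field_simp
    linarith
  linear_combination (deriv g (a * Real.exp (s / √N)) * (a * Real.exp (s / √N))) * hdiv

theorem monotone_deriv_saddleWell {g : ℝ → ℝ}
    (hmono : StrictMonoOn (fun r => r * deriv g r) (Set.Ioi 0)) (N : ℕ) {a : ℝ} (ha : 0 < a) :
    Monotone fun s => √N * (a * Real.exp (s / √N) * deriv g (a * Real.exp (s / √N))
      - a * deriv g a) := by
  intro s s' hs
  have h1 : a * Real.exp (s / √N) ≤ a * Real.exp (s' / √N) := by gcongr
  have := hmono.monotoneOn (Set.mem_Ioi.2 (by positivity : 0 < a * Real.exp (s / √N)))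
    (Set.mem_Ioi.2 (by positivity : 0 < a * Real.exp (s' / √N))) h1
  simp only at this ⊢
  gcongr

theorem isConvexWell_saddleWell {g : ℝ → ℝ} (hg : DifferentiableOn ℝ g (Set.Ioi 0))
    (hmono : StrictMonoOn (fun r => r * deriv g r) (Set.Ioi 0)) {N : ℕ} (hN : 1 ≤ N) {a : ℝ}
    (ha : 0 < a) : IsConvexWell (saddleWell N g a) := by
  have hd := hasDerivAt_saddleWell hg hN ha
  have hm := monotone_deriv_saddleWell hmono N ha
  have hderiv : deriv (saddleWell N g a) = _ := funext fun s => (hd s).deriv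
  have hdiff : Differentiable ℝ (saddleWell N g a) := fun s => (hd s).differentiableAt
  refine ⟨Monotone.convexOn_univ_of_deriv hdiff (by rw [hderiv]; exact hm),
    saddleWell_zero N g a, fun s => ?_⟩
  have hd0 : deriv (saddleWell N g a) 0 = 0 := by rw [(hd 0).deriv]; simp
  rw [← hderiv] at hm
  rw [← saddleWell_zero N g a]
  rcases le_total 0 s with hs | hs
  · refine monotoneOn_of_deriv_nonneg (convex_Ici 0) hdiff.continuous.continuousOn
      hdiff.differentiableOn (fun x hx => ?_) Set.self_mem_Ici hs hs
    rw [← hd0]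
    exact hm (interior_subset hx)
  · refine antitoneOn_of_deriv_nonpos (convex_Iic 0) hdiff.continuous.continuousOn
      hdiff.differentiableOn (fun x hx => ?_) hs Set.self_mem_Iic hs
    rw [← hd0]
    exact hm (interior_subset hx : x ∈ Set.Iic 0)

theorem exp_saddleGrid_sub_saddleWell {N : ℕ} (hN : 1 ≤ N) (g : ℝ → ℝ) {a : ℝ} (ha : 0 < a)
    (k s : ℝ) :
    Real.exp (4 * k * (Real.log a + s / √N) - N * g (Real.exp (Real.log a + s / √N)))
      = Real.exp (4 * k * Real.log a - N * g a)
        * Real.exp (saddleGrid N (a * deriv g a) k * s - saddleWell N g a s) := by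
  have hN0 : (0 : ℝ) < N := by exact_mod_cast hN
  have hs : √(N : ℝ) ≠ 0 := by positivity
  have hsq : √(N : ℝ) * √N = N := Real.mul_self_sqrt hN0.le
  rw [← Real.exp_add, Real.exp_add (Real.log a), Real.exp_log ha, saddleGrid, saddleWell]
  congr 1
  have : (N : ℝ) / √N = √N := by field_simp; linarith
  have h2 : (4 * k - N * (a * deriv g a)) / √N * s
      = 4 * k * (s / √N) - √N * (a * deriv g a) * s := by
    linear_combination (-(a * deriv g a) * s) * this
  rw [h2]
  ring

theorem integral_comp_add_div_sqrt {N : ℕ} (hN : 1 ≤ N) (x : ℝ) (G : ℝ → ℝ) :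
    ∫ t, G t = (√N)⁻¹ * ∫ s, G (x + s / √N) := by
  have hs : 0 < √(N : ℝ) := by
    have : (0 : ℝ) < N := by exact_mod_cast hN
    positivity
  rw [Measure.integral_comp_div (fun t => G (x + t)), integral_add_left_eq_self G x, abs_of_pos hs,
    smul_eq_mul]
  field_simp

theorem integrable_exp_saddleGrid {g : ℝ → ℝ} (hg : DifferentiableOn ℝ g (Set.Ioi 0))
    (hgrowth : Tendsto (fun r => g r / Real.log r) atTop atTop)
    (hzero : Tendsto (fun r => r * deriv g r) (𝓝[>] 0) (𝓝 0)) {N : ℕ} (hN : 1 ≤ N) {a : ℝ}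
    (ha : 0 < a) {k : ℝ} (hk : 0 < k) :
    Integrable fun s => Real.exp (saddleGrid N (a * deriv g a) k * s - saddleWell N g a s) := by
  have hs : √(N : ℝ) ≠ 0 := by
    have : (0 : ℝ) < N := by exact_mod_cast hN
    positivity
  have h1 := integrable_exp_mul_sub hg hgrowth hzero hN (m := 4 * k) (by positivity)
  have h2 := (h1.comp_add_left (Real.log a)).comp_div hs
  simp_rw [exp_saddleGrid_sub_saddleWell hN g ha] at h2
  exact (integrable_const_mul_iff (Real.exp_pos _).ne'.isUnit _).1 h2

/-- The expectation of a function of one radius that is `w` inside the disc and `1` outside: the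
index `i` carries the moment of order `4 i + 2`, which is the tilt of index `i + 1`. -/
theorem moment_ratio_eq {g : ℝ → ℝ} (hg : DifferentiableOn ℝ g (Set.Ioi 0))
    (hgrowth : Tendsto (fun r => g r / Real.log r) atTop atTop)
    (hzero : Tendsto (fun r => r * deriv g r) (𝓝[>] 0) (𝓝 0)) {N : ℕ} (hN : 1 ≤ N) {a : ℝ}
    (ha : 0 < a) (i : ℕ) (w : ℝ) :
    (∫ z : ℂ, ‖z‖ ^ (2 * (2 * i + 1)) * ((if ‖z‖ ≤ a then w else 1) * Real.exp (-(N * g ‖z‖)))) /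
        ∫ z : ℂ, ‖z‖ ^ (2 * (2 * i + 1)) * Real.exp (-(N * g ‖z‖))
      = 1 - tiltedProb (saddleWell N g a) (saddleGrid N (a * deriv g a) ((i + 1 : ℕ) : ℝ))
        + tiltedProb (saddleWell N g a) (saddleGrid N (a * deriv g a) ((i + 1 : ℕ) : ℝ)) * w := by
  obtain ⟨C, hC, hF⟩ := exists_integral_norm_eq
  have hN0 : (0 : ℝ) < N := by exact_mod_cast hN
  have hs : 0 < √(N : ℝ) := by positivity
  set k : ℝ := ((i + 1 : ℕ) : ℝ) with hk
  have hi := integrable_exp_saddleGrid hg hgrowth hzero hN ha (k := k) (by positivity)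
  set E : ℝ → ℝ := fun s => Real.exp (saddleGrid N (a * deriv g a) k * s - saddleWell N g a s)
    with hE
  set B : ℝ := Real.exp (4 * k * Real.log a - N * g a) with hB
  have hmain : ∀ w : ℝ, ∫ z : ℂ, ‖z‖ ^ (2 * (2 * i + 1)) *
        ((if ‖z‖ ≤ a then w else 1) * Real.exp (-(N * g ‖z‖)))
      = C * ((√N)⁻¹ * (B * (w * (∫ s in Set.Iic 0, E s) + ∫ s in Set.Ioi 0, E s))) := by
    intro w
    rw [hF fun r => r ^ (2 * (2 * i + 1)) * ((if r ≤ a then w else 1) * Real.exp (-(N * g r))),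
      integral_comp_add_div_sqrt hN (Real.log a)]
    congr 2
    have hpt : ∀ s, Real.exp (2 * (Real.log a + s / √N)) *
        (Real.exp (Real.log a + s / √N) ^ (2 * (2 * i + 1)) *
          ((if Real.exp (Real.log a + s / √N) ≤ a then w else 1) *
            Real.exp (-(N * g (Real.exp (Real.log a + s / √N))))))
        = B * (w * (Set.Iic 0).indicator E s + (Set.Ioi 0).indicator E s) := by
      intro s
      have h1 : Real.exp (2 * (Real.log a + s / √N)) *
          Real.exp (Real.log a + s / √N) ^ (2 * (2 * i + 1)) *
            Real.exp (-(N * g (Real.exp (Real.log a + s / √N)))) = B * E s := by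
        rw [hB, hE, ← exp_saddleGrid_sub_saddleWell hN g ha, ← Real.exp_nat_mul, ← Real.exp_add,
          ← Real.exp_add, hk]
        congr 1
        push_cast
        ring
      have h2 : Real.exp (Real.log a + s / √N) ≤ a ↔ s ≤ 0 := by
        rw [← Real.le_log_iff_exp_le ha, add_le_iff_nonpos_right, div_nonpos_iff]
        constructor
        · rintro (h | h)
          · linarith [h.2]
          · exact h.1
        · exact fun h => Or.inr ⟨h, hs.le⟩
      by_cases h : s ≤ 0
      · rw [if_pos (h2.2 h), Set.indicator_of_mem (Set.mem_Iic.2 h),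
          Set.indicator_of_notMem (by simpa using h)]
        linear_combination w * h1
      · rw [if_neg fun h' => h (h2.1 h'), Set.indicator_of_notMem (by simpa using h),
          Set.indicator_of_mem (by simpa using h)]
        linear_combination h1
    simp_rw [hpt]
    rw [integral_const_mul, integral_add ((hi.indicator measurableSet_Iic).const_mul w)
      (hi.indicator measurableSet_Ioi), integral_const_mul, integral_indicator measurableSet_Iic,
      integral_indicator measurableSet_Ioi]
  have hone := hmain 1
  simp only [ite_self, one_mul] at hone
  have htot := integral_add_compl (μ := volume) (measurableSet_Iic (a := (0 : ℝ))) hi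
  rw [Set.compl_Iic] at htot
  have hpos := integral_exp_pos hi
  rw [hmain w, hone, tiltedProb, htot]
  change 0 < ∫ s, E s at hpos
  change _ = 1 - (∫ s in Set.Iic 0, E s) / (∫ s, E s) + (∫ s in Set.Iic 0, E s) / (∫ s, E s) * w
  have h3 : ∫ s in Set.Ioi 0, E s = (∫ s, E s) - ∫ s in Set.Iic 0, E s := by linarith
  rw [h3]
  have hB0 : B ≠ 0 := (Real.exp_pos _).ne'
  have hs0 := hs.ne'
  have hp0 := hpos.ne'
  field_simp
  ring

/-! ### Cumulants -/

theorem discCumulant_eq_sum {g : ℝ → ℝ} (hg : DifferentiableOn ℝ g (Set.Ioi 0))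
    (hgrowth : Tendsto (fun r => g r / Real.log r) atTop atTop)
    (hzero : Tendsto (fun r => r * deriv g r) (𝓝[>] 0) (𝓝 0)) {N : ℕ} (hN : 1 ≤ N) {a : ℝ}
    (ha : 0 < a) (n : ℕ) :
    discCumulant N (radialPotential g) (n + 1) a
      = ∑ k ∈ Finset.Icc 1 N, (bernoulliCumulantPoly n).eval
          (tiltedProb (saddleWell N g a) (saddleGrid N (a * deriv g a) k)) := by
  set P : ℕ → ℝ := fun k => tiltedProb (saddleWell N g a) (saddleGrid N (a * deriv g a) k) with hP
  have hPm : ∀ k, P k ∈ Set.Icc (0 : ℝ) 1 := fun k => tiltedProb_mem_Icc _ _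
  have hcgf : ProbabilityTheory.cgf (discCount a) (symplecticEnsemble N (radialPotential g))
      = fun u => ∑ k ∈ Finset.Icc 1 N, Real.log (1 - P k + P k * Real.exp u) := by
    ext u
    rw [ProbabilityTheory.cgf,
      mgf_discCount (fun n => integrable_pow_mul_exp_neg hg hgrowth hzero hN n)]
    simp_rw [moment_ratio_eq hg hgrowth hzero hN ha]
    have hpos : ∀ k, 0 < 1 - P k + P k * Real.exp u := by
      intro k
      rcases (hPm k).1.eq_or_lt with h | h
      · simp [← h]
      · have := mul_pos h (Real.exp_pos u)
        linarith [(hPm k).2]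
    change Real.log (∏ i : Fin N, (1 - P ((i : ℕ) + 1) + P ((i : ℕ) + 1) * Real.exp u)) = _
    rw [Real.log_prod fun (i : Fin N) _ => (hpos ((i : ℕ) + 1)).ne',
      Fin.sum_univ_eq_sum_range (fun i => Real.log (1 - P (i + 1) + P (i + 1) * Real.exp u)) N,
      Finset.range_eq_Ico,
      Finset.sum_Ico_add' (fun k => Real.log (1 - P k + P k * Real.exp u)) 0 N 1]
    rfl
  rw [discCumulant, hcgf, iteratedDeriv_fun_sum fun k _ =>
    (contDiff_log_bernoulli (hPm k)).contDiffAt]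
  refine Finset.sum_congr rfl fun k _ => ?_
  rw [iteratedDeriv_log_bernoulli n (hPm k)]
  simp [hP]

/-! ### Suitable potentials with a regular limit -/

theorem tendsto_sqrt_mul_exp_sub_one (s : ℝ) :
    Tendsto (fun N : ℕ => √N * (Real.exp (s / √N) - 1)) atTop (𝓝 s) := by
  have h1 : HasDerivAt (fun x : ℝ => Real.exp (s * x)) s 0 := by
    have := ((hasDerivAt_id (0 : ℝ)).const_mul s).exp
    simpa using this
  have h2 := hasDerivAt_iff_tendsto_slope_zero.1 h1
  have hsq : Tendsto (fun N : ℕ => √(N : ℝ)) atTop atTop :=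
    Real.tendsto_sqrt_atTop.comp tendsto_natCast_atTop_atTop
  have h3 : Tendsto (fun N : ℕ => (√(N : ℝ))⁻¹) atTop (𝓝[≠] 0) :=
    tendsto_nhdsWithin_iff.2 ⟨hsq.inv_tendsto_atTop, by
      filter_upwards [hsq.eventually_gt_atTop 0] with N hN using inv_ne_zero hN.ne'⟩
  refine (h2.comp h3).congr fun N => ?_
  simp [div_eq_mul_inv]

namespace IsSuitable

variable {g : ℕ → ℝ → ℝ}

theorem mul_deriv_pos (hg : IsSuitable g) {N : ℕ} (hN : 1 ≤ N) {r : ℝ} (hr : 0 < r) :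
    0 < r * deriv (g N) r := by
  have hm := hg.increasing N hN
  have hr2 : 0 < r / 2 := by positivity
  have h1 : r / 2 * deriv (g N) (r / 2) < r * deriv (g N) r := hm hr2 hr (by linarith)
  have h2 : 0 ≤ r / 2 * deriv (g N) (r / 2) := by
    refine le_of_tendsto (hg.tendsto_zero N hN) ?_
    filter_upwards [Ioo_mem_nhdsGT hr2] with x hx
    exact (hm hx.1 hr2 hx.2).le
  linarith

theorem uniform_linear_approx (hg : IsSuitable g) {D : ℝ → ℝ} {b : ℝ}
    (hconv : TendstoLocallyUniformlyOn
      (fun N (r : ℝ) => quarterLaplacian (radialPotential (g N)) (r : ℂ)) D atTop (Set.Ioo 0 b))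
    {α : ℝ} (hα : α ∈ Set.Ioo 0 b) {ε : ℝ} (hε : 0 < ε) :
    ∃ δ > 0, ∀ᶠ N in atTop, ∀ r, |r - α| < δ →
      |r * deriv (g N) r - α * deriv (g N) α - 4 * α * D α * (r - α)| ≤ ε * |r - α| := by
  have hb : 0 < b := hα.1.trans hα.2
  have hL : TendstoLocallyUniformlyOn
      (fun N (r : ℝ) => 4 * r * quarterLaplacian (radialPotential (g N)) (r : ℂ))
      (fun r => 4 * r * D r) atTop (Set.Ioo 0 b) := by
    rw [Metric.tendstoLocallyUniformlyOn_iff] at hconv ⊢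
    intro ε hε x hx
    obtain ⟨t, ht, h⟩ := hconv (ε / (4 * b)) (by positivity) x hx
    refine ⟨t ∩ Set.Ioo 0 b, inter_mem ht self_mem_nhdsWithin, ?_⟩
    filter_upwards [h] with N hN y hy
    have h1 := hN y hy.1
    rw [Real.dist_eq] at h1 ⊢
    rw [← mul_sub, abs_mul, abs_of_pos (by linarith [hy.2.1] : 0 < 4 * y)]
    rw [lt_div_iff₀ (by positivity)] at h1
    calc 4 * y * |D y - quarterLaplacian (radialPotential (g N)) (y : ℂ)|
        ≤ 4 * b * |D y - quarterLaplacian (radialPotential (g N)) (y : ℂ)| := by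
          gcongr
          exact hy.2.2.le
      _ < ε := by linarith
  refine exists_uniform_linear_approx (q := fun N r => r * deriv (g N) r) isOpen_Ioo ?_ hL hα hε
  filter_upwards [eventually_ge_atTop 1] with N hN r hr
  exact hasDerivAt_mul_deriv (hg.differentiable N hN) (hg.differentiable_deriv N hN) hr.1

/-- `q_N(r) = r g_N'(r)` stays away from its value `0` at the origin. -/
theorem exists_le_mul_deriv (hg : IsSuitable g) {D : ℝ → ℝ} {b : ℝ}
    (hconv : TendstoLocallyUniformlyOn
      (fun N (r : ℝ) => quarterLaplacian (radialPotential (g N)) (r : ℂ)) D atTop (Set.Ioo 0 b))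
    {α : ℝ} (hα : α ∈ Set.Ioo 0 b) (hD : 0 < D α) :
    ∃ η > 0, ∀ᶠ N in atTop, η ≤ α * deriv (g N) α := by
  have hα0 := hα.1
  have hκ : 0 < 4 * α * D α := by positivity
  obtain ⟨δ, hδ, h⟩ := hg.uniform_linear_approx hconv hα (half_pos hκ)
  have hh : 0 < min (δ / 2) (α / 2) := by positivity
  set h0 := min (δ / 2) (α / 2)
  have h1 : h0 ≤ δ / 2 := min_le_left _ _
  have h2 : h0 ≤ α / 2 := min_le_right _ _
  refine ⟨4 * α * D α / 2 * h0, by positivity, ?_⟩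
  filter_upwards [h, eventually_ge_atTop 1] with N hN hN1
  have habs : |α - h0 - α| = h0 := by rw [sub_sub_cancel_left, abs_neg, abs_of_pos hh]
  have h3 := hN (α - h0) (by rw [habs]; linarith)
  rw [habs] at h3
  have h4 := hg.mul_deriv_pos hN1 (by linarith : 0 < α - h0)
  have h5 := (abs_le.1 h3).2
  linarith

/-- Inside the unit disc, `q_N(r) = r g_N'(r)` stays away from its limit `4` at `r = 1`. -/
theorem exists_mul_deriv_le (hg : IsSuitable g) {D : ℝ → ℝ} {b : ℝ}
    (hconv : TendstoLocallyUniformlyOn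
      (fun N (r : ℝ) => quarterLaplacian (radialPotential (g N)) (r : ℂ)) D atTop (Set.Ioo 0 b))
    {α : ℝ} (hα : α ∈ Set.Ioo 0 b) (hα1 : α < 1) (hD : 0 < D α) :
    ∃ η > 0, ∀ᶠ N in atTop, α * deriv (g N) α ≤ 4 - η := by
  have hα0 := hα.1
  have hκ : 0 < 4 * α * D α := by positivity
  obtain ⟨δ, hδ, h⟩ := hg.uniform_linear_approx hconv hα (half_pos hκ)
  have hh : 0 < min (δ / 2) (1 - α) := lt_min (by positivity) (by linarith)
  set h0 := min (δ / 2) (1 - α)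
  have h1 : h0 ≤ δ / 2 := min_le_left _ _
  have h2 : h0 ≤ 1 - α := min_le_right _ _
  have hη : 0 < 4 * α * D α / 4 * h0 := by positivity
  refine ⟨4 * α * D α / 4 * h0, hη, ?_⟩
  filter_upwards [h, eventually_ge_atTop 1,
    hg.tendsto_one.eventually_lt_const (by linarith : (4 : ℝ) < 4 + 4 * α * D α / 4 * h0)]
    with N hN hN1 h4
  have habs : |α + h0 - α| = h0 := by rw [add_sub_cancel_left, abs_of_pos hh]
  have h3 := hN (α + h0) (by rw [habs]; linarith)
  rw [habs] at h3
  have h5 := (abs_le.1 h3).1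
  have h6 : (α + h0) * deriv (g N) (α + h0) ≤ 1 * deriv (g N) 1 :=
    (hg.increasing N hN1).monotoneOn (Set.mem_Ioi.2 (by linarith)) (Set.mem_Ioi.2 one_pos)
      (by linarith)
  linarith

/-- The cumulants for a disc whose radius is within `O(N^{-1/2})` of `α`. The set `A` is the
limiting range of the tilts, whose largest value is `√N (4 - q_N(r_N))` with `q_N(r) = r g_N'(r)`. -/
theorem tendsto_discCumulant (hg : IsSuitable g) {D : ℝ → ℝ} {b : ℝ}
    (hconv : TendstoLocallyUniformlyOn
      (fun N (r : ℝ) => quarterLaplacian (radialPotential (g N)) (r : ℂ)) D atTop (Set.Ioo 0 b))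
    {α : ℝ} (hα : α ∈ Set.Ioo 0 b) (hD : 0 < D α) (n : ℕ) {r : ℕ → ℝ} {ρ : ℝ}
    (hr : Tendsto (fun N : ℕ => √N * (r N - α)) atTop (𝓝 ρ)) {A : Set ℝ} (hA : MeasurableSet A)
    (hup : ∀ᵐ y : ℝ,
      (y ∈ A ∧ ∀ᶠ N : ℕ in atTop, y ≤ √N * (4 - r N * deriv (g N) (r N))) ∨
      (y ∉ A ∧ ∀ᶠ N : ℕ in atTop, √N * (4 - r N * deriv (g N) (r N)) < y)) :
    Tendsto (fun N : ℕ => √(2 / (N * quarterLaplacian (radialPotential (g N)) (α : ℂ))) *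
        discCumulant N (radialPotential (g N)) (n + 2) (r N)) atTop
      (𝓝 (√(2 / D α) * (1 / 4 * ∫ y in A,
        (bernoulliCumulantPoly (n + 1)).eval (erfc (y / (2 * α * √(2 * D α))) / 2)))) := by
  have hα0 := hα.1
  have hsq : Tendsto (fun N : ℕ => √(N : ℝ)) atTop atTop :=
    Real.tendsto_sqrt_atTop.comp tendsto_natCast_atTop_atTop
  have hrα : Tendsto r atTop (𝓝 α) := by
    have h1 := hsq.inv_tendsto_atTop.mul hr
    rw [zero_mul] at h1
    have h2 := h1.add_const α
    rw [zero_add] at h2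
    refine h2.congr' ?_
    filter_upwards [hsq.eventually_gt_atTop 0] with N hN
    simp only [Pi.inv_apply]
    field_simp
    ring
  have hr0 : ∀ᶠ N in atTop, 0 < r N := hrα.eventually_const_lt hα0
  have hlin : ∀ {x : ℕ → ℝ} {ξ : ℝ}, Tendsto (fun N : ℕ => √N * (x N - α)) atTop (𝓝 ξ) →
      Tendsto (fun N : ℕ => √N * (x N * deriv (g N) (x N) - α * deriv (g N) α)) atTop
        (𝓝 (4 * α * D α * ξ)) := fun hx =>
    tendsto_mul_sub_of_uniform_linear_approx (q := fun N r => r * deriv (g N) r)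
      (fun ε hε => hg.uniform_linear_approx hconv hα hε) hsq hx
  have hq := hlin hr
  set Γ : ℕ → ℝ → ℝ := fun N => saddleWell N (g N) (r N) with hΓ
  have hc : 0 < 4 * α ^ 2 * D α := by positivity
  have hlim : ∀ s, Tendsto (fun N => Γ N s) atTop (𝓝 (4 * α ^ 2 * D α * s ^ 2 / 2)) := by
    refine tendsto_of_hasDerivAt_monotone
      (d := fun N s => √N * (r N * Real.exp (s / √N) * deriv (g N) (r N * Real.exp (s / √N))
      - r N * deriv (g N) (r N))) ?_ ?_ (fun N => saddleWell_zero _ _ _) fun s => ?_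
    · filter_upwards [hr0, eventually_ge_atTop 1] with N h1 h2
      exact hasDerivAt_saddleWell (hg.differentiable N h2) h2 h1
    · filter_upwards [hr0, eventually_ge_atTop 1] with N h1 h2
      exact monotone_deriv_saddleWell (hg.increasing N h2) N h1
    · have h1 : Tendsto (fun N : ℕ => √N * (r N * Real.exp (s / √N) - α)) atTop
          (𝓝 (α * s + ρ)) := by
        refine ((hrα.mul (tendsto_sqrt_mul_exp_sub_one s)).add hr).congr fun N => ?_
        ring
      have h2 := (hlin h1).sub hq
      convert h2 using 2
      · ring
      · ring
  have hlow : ∀ y, ∀ᶠ N : ℕ in atTop, saddleGrid N (r N * deriv (g N) (r N)) 0 < y := by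
    intro y
    obtain ⟨η, hη, hN⟩ := hg.exists_le_mul_deriv hconv hα hD
    have h1 : Tendsto (fun N : ℕ => √N * η + √N * (r N * deriv (g N) (r N) - α * deriv (g N) α))
        atTop atTop := (hsq.atTop_mul_const hη).atTop_add hq
    filter_upwards [hN, h1.eventually_gt_atTop (-y), hsq.eventually_gt_atTop 0] with N h2 h3 h4
    have h5 : saddleGrid N (r N * deriv (g N) (r N)) 0 = -(√N * (r N * deriv (g N) (r N))) := by
      have : (N : ℝ) = √N * √N := (Real.mul_self_sqrt (Nat.cast_nonneg N)).symm
      rw [saddleGrid, div_eq_iff h4.ne']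
      linear_combination -(r N * deriv (g N) (r N)) * this
    rw [h5]
    have h6 := mul_le_mul_of_nonneg_left h2 h4.le
    linarith
  have hgridN : ∀ᶠ N : ℕ in atTop, saddleGrid N (r N * deriv (g N) (r N)) N
      = √N * (4 - r N * deriv (g N) (r N)) := by
    filter_upwards [hsq.eventually_gt_atTop 0] with N h4
    have : (N : ℝ) = √N * √N := (Real.mul_self_sqrt (Nat.cast_nonneg N)).symm
    rw [saddleGrid, div_eq_iff h4.ne']
    linear_combination (4 - r N * deriv (g N) (r N)) * this
  obtain ⟨C, hC0, hC⟩ := exists_abs_eval_bernoulliCumulantPoly_le n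
  have key := tendsto_sum_tiltedProb (Γ := Γ) (Q := fun N => r N * deriv (g N) (r N)) hc ?_ hlim ?_
    hA hlow ?_ (f := fun x => (bernoulliCumulantPoly (n + 1)).eval x)
    (bernoulliCumulantPoly (n + 1)).continuous hC0 hC
  · have hLap : Tendsto (fun N => quarterLaplacian (radialPotential (g N)) (α : ℂ)) atTop
        (𝓝 (D α)) := hconv.tendsto_at hα
    have hpre : Tendsto (fun N => √(2 / quarterLaplacian (radialPotential (g N)) (α : ℂ))) atTop
        (𝓝 (√(2 / D α))) :=
      (Real.continuous_sqrt.tendsto _).comp (tendsto_const_nhds.div hLap hD.ne')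
    have hc' : √(2 * (4 * α ^ 2 * D α)) = 2 * α * √(2 * D α) := by
      rw [show 2 * (4 * α ^ 2 * D α) = (2 * α) ^ 2 * (2 * D α) by ring,
        Real.sqrt_mul (by positivity), Real.sqrt_sq (by positivity)]
    rw [hc'] at key
    refine (hpre.mul key).congr' ?_
    filter_upwards [hr0, eventually_ge_atTop 1, hLap.eventually_const_lt hD] with N h1 h2 h3
    rw [discCumulant_eq_sum (hg.differentiable N h2) (hg.growth N h2) (hg.tendsto_zero N h2) h2 h1
      (n + 1), ← mul_assoc]
    congr 1
    rw [mul_comm (N : ℝ), ← div_div, Real.sqrt_div (div_nonneg zero_le_two h3.le),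
      ← div_eq_mul_inv]
  · filter_upwards [hr0, eventually_ge_atTop 1] with N h1 h2
    exact isConvexWell_saddleWell (hg.differentiable N h2) (hg.increasing N h2) h2 h1
  · filter_upwards [hr0, eventually_ge_atTop 1] with N h1 h2 k hk
    have hk1 : (0 : ℝ) < k := by exact_mod_cast (Finset.mem_Icc.1 hk).1
    exact integrable_exp_saddleGrid (hg.differentiable N h2) (hg.growth N h2)
      (hg.tendsto_zero N h2) h2 h1 hk1
  · filter_upwards [hup] with y hy
    refine hy.imp (fun h => ⟨h.1, ?_⟩) fun h => ⟨h.1, ?_⟩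
    · filter_upwards [h.2, hgridN] with N h1 h2
      rwa [h2]
    · filter_upwards [h.2, hgridN] with N h1 h2
      rwa [h2]

end IsSuitable

theorem theorem2p11 (g : ℕ → ℝ → ℝ) (hg : IsSuitable g) (hreg : HasRegularLimit g)
    (p : ℕ) (hp : 2 ≤ p) :
    MeasureTheory.Integrable (polylogErfc p) ∧
    (Even p → bulkCumulant p = -∫ x, polylogErfc p x) ∧
    (Odd p → bulkCumulant p = 0) ∧
    (∀ a ∈ Set.Ioo (0 : ℝ) 1,
      Filter.Tendsto
        (fun N : ℕ =>
          Real.sqrt (2 / (N * quarterLaplacian (radialPotential (g N)) (a : ℂ))) *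
            discCumulant N (radialPotential (g N)) p a)
        Filter.atTop (nhds (a * bulkCumulant p))) ∧
    (Filter.Tendsto (fun N : ℕ => Real.sqrt N * (deriv (g N) 1 - 4)) Filter.atTop (nhds 0) →
      ∀ S : ℝ,
        Filter.Tendsto
          (fun N : ℕ =>
            Real.sqrt (2 / (N * quarterLaplacian (radialPotential (g N)) 1)) *
              discCumulant N (radialPotential (g N)) p
                (1 - S / Real.sqrt (2 * quarterLaplacian (radialPotential (g N)) 1 * N)))
          Filter.atTop (nhds (edgeCumulant p S))) := by
  obtain ⟨n, rfl⟩ := Nat.exists_eq_add_of_le' hp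
  obtain ⟨D, b, hb, hD, hconv⟩ := hreg
  have hsq : Tendsto (fun N : ℕ => √(N : ℝ)) atTop atTop :=
    Real.tendsto_sqrt_atTop.comp tendsto_natCast_atTop_atTop
  have hcoef : ∀ {d : ℝ}, 0 < d → ∀ α : ℝ, √(2 / d) * (1 / 4 * (2 * α * √(2 * d))) = α := by
    intro d hd α
    have h1 : √(2 / d) * √(2 * d) = 2 := by
      rw [← Real.sqrt_mul (by positivity), show 2 / d * (2 * d) = 2 ^ 2 by field_simp,
        Real.sqrt_sq (by norm_num)]
    linear_combination (α / 2) * h1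
  refine ⟨integrable_polylogErfc n, fun h => ?_, fun h => bulkCumulant_of_odd ?_, fun a ha => ?_,
    fun hedge S => ?_⟩
  · rw [bulkCumulant, (h.add_one).neg_one_pow, neg_one_mul]
  · simpa [Nat.odd_add] using h
  · have haD := hD a ⟨ha.1, ha.2.le⟩
    have hab : a ∈ Set.Ioo 0 b := ⟨ha.1, ha.2.trans hb⟩
    have ha0 := ha.1
    have h1 := hg.tendsto_discCumulant hconv hab haD n (r := fun _ => a) (ρ := 0) (by simp)
      MeasurableSet.univ (ae_of_all _ fun y => Or.inl ⟨Set.mem_univ y, by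
        obtain ⟨η, hη, hN⟩ := hg.exists_mul_deriv_le hconv hab ha.2 haD
        filter_upwards [hN, (hsq.atTop_mul_const hη).eventually_ge_atTop y] with N h1 h2
        refine h2.trans ?_
        gcongr
        linarith⟩)
    have h2 : √(2 / D a) * (1 / 4 * ∫ y in Set.univ,
        (bernoulliCumulantPoly (n + 1)).eval (erfc (y / (2 * a * √(2 * D a))) / 2))
        = a * bulkCumulant (n + 2) := by
      rw [setIntegral_univ, Measure.integral_comp_div
        (fun x => (bernoulliCumulantPoly (n + 1)).eval (erfc x / 2)), abs_of_pos (by positivity),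
        smul_eq_mul, ← bulkCumulant_eq]
      linear_combination bulkCumulant (n + 2) * hcoef haD a
    rwa [h2] at h1
  · have hD1 := hD 1 ⟨one_pos, le_rfl⟩
    have h1b : (1 : ℝ) ∈ Set.Ioo 0 b := ⟨one_pos, hb⟩
    have hLap : Tendsto (fun N => quarterLaplacian (radialPotential (g N)) 1) atTop
        (𝓝 (D 1)) := by
      simpa using hconv.tendsto_at h1b
    set r : ℕ → ℝ := fun N =>
      1 - S / √(2 * quarterLaplacian (radialPotential (g N)) 1 * N) with hrdef
    have hr : Tendsto (fun N : ℕ => √N * (r N - 1)) atTop (𝓝 (-(S / √(2 * D 1)))) := by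
      have h1 : Tendsto (fun N => -(S / √(2 * quarterLaplacian (radialPotential (g N)) 1))) atTop
          (𝓝 (-(S / √(2 * D 1)))) :=
        (tendsto_const_nhds.div ((Real.continuous_sqrt.tendsto _).comp (hLap.const_mul 2))
          (by positivity)).neg
      refine h1.congr' ?_
      filter_upwards [hsq.eventually_gt_atTop 0, hLap.eventually_const_lt hD1] with N h2 h3
      simp only [hrdef]
      rw [Real.sqrt_mul (mul_nonneg zero_le_two h3.le)]
      have : √(2 * quarterLaplacian (radialPotential (g N)) 1) ≠ 0 := by positivity
      field_simp
      ring
    have hY : Tendsto (fun N : ℕ => √N * (4 - r N * deriv (g N) (r N))) atTop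
        (𝓝 (2 * √(2 * D 1) * S)) := by
      have h1 := tendsto_mul_sub_of_uniform_linear_approx (q := fun N r => r * deriv (g N) r)
        (fun ε hε => hg.uniform_linear_approx hconv h1b hε) hsq hr
      have h2 := (hedge.add h1).neg
      have h3 : -(0 + 4 * 1 * D 1 * -(S / √(2 * D 1))) = 2 * √(2 * D 1) * S := by
        have h4 : √(2 * D 1) * √(2 * D 1) = 2 * D 1 := Real.mul_self_sqrt (by positivity)
        have h5 : √(2 * D 1) ≠ 0 := by positivity
        generalize √(2 * D 1) = w at h4 h5 ⊢
        field_simp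
        linear_combination (-2 * S) * h4
      rw [h3] at h2
      refine h2.congr fun N => ?_
      ring
    have h1 := hg.tendsto_discCumulant hconv h1b hD1 n hr
      (measurableSet_Iic (a := 2 * √(2 * D 1) * S)) (by
        filter_upwards [Measure.ae_ne volume (2 * √(2 * D 1) * S)] with y hy
        rcases hy.lt_or_gt with h | h
        · exact Or.inl ⟨h.le, (hY.eventually_const_lt h).mono fun N h => h.le⟩
        · exact Or.inr ⟨not_le.2 h, hY.eventually_lt_const h⟩)
    have h2 : √(2 / D 1) * (1 / 4 * ∫ y in Set.Iic (2 * √(2 * D 1) * S),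
        (bernoulliCumulantPoly (n + 1)).eval (erfc (y / (2 * 1 * √(2 * D 1))) / 2))
        = edgeCumulant (n + 2) S := by
      have hpos : 0 < 2 * 1 * √(2 * D 1) := by positivity
      have h3 : ∀ y, (Set.Iic (2 * √(2 * D 1) * S)).indicator (fun y =>
          (bernoulliCumulantPoly (n + 1)).eval (erfc (y / (2 * 1 * √(2 * D 1))) / 2)) y
          = (Set.Iic S).indicator (fun x => (bernoulliCumulantPoly (n + 1)).eval (erfc x / 2))
            (y / (2 * 1 * √(2 * D 1))) := by
        intro y
        have h4 : y ∈ Set.Iic (2 * √(2 * D 1) * S) ↔ y / (2 * 1 * √(2 * D 1)) ∈ Set.Iic S := by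
          rw [Set.mem_Iic, Set.mem_Iic, div_le_iff₀ hpos]
          constructor <;> intro h <;> linarith
        simp only [Set.indicator, h4]
      rw [← integral_indicator measurableSet_Iic]
      simp_rw [h3]
      rw [Measure.integral_comp_div, integral_indicator measurableSet_Iic, abs_of_pos hpos,
        smul_eq_mul, ← edgeCumulant_eq]
      linear_combination edgeCumulant (n + 2) S * hcoef hD1 1
    rw [h2] at h1
    rwa [Complex.ofReal_one] at h1
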